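/- Let $p>2$ be real. A single-knot metric graph $\mathcal G$ consists of $H\ge 1$ half-lines, each identified with $[0,\infty)$, and a finite set $\mathcal K$ of bounded edges $\kappa$, each of length $\ell_\kappa\in(0,\infty)$ and identified with $[0,\ell_\kappa]$. The edges in $\mathcal K$ are $P\ge 0$ pendants and $L\ge 0$ loops. All edges are attached at a single vertex $\mathbf 0$: the point $x=0$ of every edge is $\mathbf 0$, and for a loop the endpoint $x=\ell_\kappa$ is $\mathbf 0$ as well. Let $H^1(\mathcal G)$ be the space of continuous functions $u:\mathcal G\to\mathbb R$ whose restriction to each edge $e$ belongs to $H^1(e)$. For $u\in H^1(\mathcal G)$ set $$S(u)=\frac12\int_{\mathcal G}\bigl(|u'|^2+|u|^2\bigr)\,dx-\frac1p\int_{\mathcal G}|u|^p\,dx .$$ A bound-state on $\mathcal G$ is a function $u\in H^1(\mathcal G)$, $u\not\equiv 0$, such that $$\int_{\mathcal G}\bigl(u'\eta'+u\eta-|u|^{p-2}u\,\eta\bigr)\,dx=0\qquad\text{for all }\eta\in H^1(\mathcal G),$$ and an action ground-state on $\mathcal G$ is a bound-state $u$ with $$S(u)=\mathcal S_{\mathcal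 G}:=\inf\{S(v): v\text{ is a bound-state on }\mathcal G\}.$$ **Theorem.** Let $\mathcal G$ be a single-knot metric graph. If $\mathcal G$ admits a bound-state and $$\sum_{\kappa\in\mathcal K,\ \kappa\text{ pendant}}\tanh \ell_\kappa+2\sum_{\kappa\in\mathcal K,\ \kappa\text{ loop}}\tanh\frac{\ell_\kappa}{2}\neq H-2n\qquad\text{for every } n=0,1,\dots,[H/2],$$ where $[\cdot]$ denotes the integer part, then there exists an action ground-state on $\mathcal G$. -/

import Mathlib

open MeasureTheory Set
open scoped ContDiff

noncomputable section

/-! Sobolev functions of one variable, through weak derivatives. -/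

/-- `g` is a weak derivative of `u` in the interior of the interval `I`: tested against all smooth
functions with compact support in the interior of `I`. -/
def IsWeakDerivOn (I : Set ℝ) (u g : ℝ → ℝ) : Prop :=
  ∀ φ : ℝ → ℝ, ContDiff ℝ ∞ φ → HasCompactSupport φ → tsupport φ ⊆ interior I →
    ∫ x in I, u x * deriv φ x = -∫ x in I, g x * φ x

/-- `u` belongs to the Sobolev space `H¹(I)`: it is square integrable on `I` and has a square
integrable weak derivative there. -/
def MemH1On (I : Set ℝ) (u : ℝ → ℝ) : Prop :=
  MemLp u 2 (volume.restrict I) ∧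
    ∃ g : ℝ → ℝ, MemLp g 2 (volume.restrict I) ∧ IsWeakDerivOn I u g

open Classical in
/-- The weak derivative `u'` on `I` of a function `u ∈ H¹(I)` (a representative; it is unique up to
null sets). -/
def weakDerivOn (I : Set ℝ) (u : ℝ → ℝ) : ℝ → ℝ :=
  if h : MemH1On I u then h.2.choose else 0

/-- The weak derivative of a function in `H¹(I)` is square integrable and is a weak derivative. -/
theorem weakDerivOn_spec {I : Set ℝ} {u : ℝ → ℝ} (h : MemH1On I u) :
    MemLp (weakDerivOn I u) 2 (volume.restrict I) ∧ IsWeakDerivOn I u (weakDerivOn I u) := by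
  unfold weakDerivOn
  rw [dif_pos h]
  exact h.2.choose_spec

/-- A single-knot metric graph: finitely many half-lines (at least one), pendants and loops, all
attached at one vertex. -/
structure SingleKnotGraph where
  numHalfLines : ℕ
  numPendants : ℕ
  numLoops : ℕ
  one_le_numHalfLines : 1 ≤ numHalfLines
  pendantLength : Fin numPendants → ℝ
  loopLength : Fin numLoops → ℝ
  pendantLength_pos : ∀ k, 0 < pendantLength k
  loopLength_pos : ∀ k, 0 < loopLength k

namespace SingleKnotGraph

/-- The edges: half-lines, then pendants, then loops. -/
abbrev Edge (G : SingleKnotGraph) : Type :=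
  Fin G.numHalfLines ⊕ Fin G.numPendants ⊕ Fin G.numLoops

/-- The interval with which an edge is identified. The common vertex is the point `0` of every edge;
for a loop it is also the other endpoint. -/
def edgeSet (G : SingleKnotGraph) : G.Edge → Set ℝ
  | .inl _ => Ici 0
  | .inr (.inl k) => Icc 0 (G.pendantLength k)
  | .inr (.inr k) => Icc 0 (G.loopLength k)

/-- Real functions on the graph, given by their restrictions to the edges. Only the values of `u e`
on `G.edgeSet e` are meaningful. -/
abbrev Fun (G : SingleKnotGraph) : Type := G.Edge → ℝ → ℝ

/-- `u ∈ C(G)`: continuous on each edge, with a single value at the common vertex. -/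
def IsContinuous (G : SingleKnotGraph) (u : G.Fun) : Prop :=
  (∀ e, ContinuousOn (u e) (G.edgeSet e)) ∧
  (∀ e e', u e 0 = u e' 0) ∧
  ∀ k : Fin G.numLoops, u (.inr (.inr k)) (G.loopLength k) = u (.inr (.inr k)) 0

/-- `u ∈ H¹(G)`. -/
def MemH1 (G : SingleKnotGraph) (u : G.Fun) : Prop :=
  G.IsContinuous u ∧ ∀ e, MemH1On (G.edgeSet e) (u e)

/-- The integral over the graph: the sum of the integrals over the edges. -/
def integral (G : SingleKnotGraph) (f : G.Fun) : ℝ :=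
  ∑ e, ∫ x in G.edgeSet e, f e x

/-- The edgewise weak derivative of `u ∈ H¹(G)`. -/
def weakDeriv (G : SingleKnotGraph) (u : G.Fun) : G.Fun :=
  fun e => weakDerivOn (G.edgeSet e) (u e)

/-- The action functional `S(u) = ½ ∫ (|u'|² + |u|²) - (1/p) ∫ |u|ᵖ`. -/
def action (G : SingleKnotGraph) (p : ℝ) (u : G.Fun) : ℝ :=
  1 / 2 * G.integral (fun e x => |G.weakDeriv u e x| ^ 2 + |u e x| ^ 2)
    - 1 / p * G.integral (fun e x => |u e x| ^ p)

/-- A bound-state: a nontrivial weak solution `u ∈ H¹(G)` of `-u'' + u = |u|^(p-2) u`. -/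
def IsBoundState (G : SingleKnotGraph) (p : ℝ) (u : G.Fun) : Prop :=
  G.MemH1 u ∧ (∃ e, ∃ x ∈ G.edgeSet e, u e x ≠ 0) ∧
  ∀ η : G.Fun, G.MemH1 η →
    G.integral (fun e x => G.weakDeriv u e x * G.weakDeriv η e x + u e x * η e x
      - |u e x| ^ (p - 2) * u e x * η e x) = 0

/-- The least action level: the infimum of the action over all bound-states, taken in the extended
reals. -/
def leastActionLevel (G : SingleKnotGraph) (p : ℝ) : EReal :=
  ⨅ (u : G.Fun) (_ : G.IsBoundState p u), (G.action p u : EReal)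

/-- An action ground-state: a bound-state that attains the least action level. -/
def IsActionGroundState (G : SingleKnotGraph) (p : ℝ) (u : G.Fun) : Prop :=
  G.IsBoundState p u ∧ (G.action p u : EReal) = G.leastActionLevel p

end SingleKnotGraph

end

/-! Testing the equation with `u` itself gives `∫ (u'² + u²) = ∫ |u|^p` for a bound-state, so the
action equals `(1/2 - 1/p) ∫ |u|^p`. A minimising sequence is therefore bounded in `H¹`.
Bound-states are classical solutions of `u'' = u - |u|^(p-2) u` with Neumann conditions at the tips
and the Kirchhoff condition at the vertex. Their Cauchy data at the vertex have a convergent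
subsequence, Grönwall's inequality carries the convergence along each edge
(`IsEdgeSolution.exists_limit`), and the limit is again a classical solution, whose `∫ |u|^p` is at
most the infimum by Fatou. Mass may escape along the half-lines, so the only danger is that the
limit is zero.

The condition on the lengths rules this out (`exists_pos_lower_bound`). Suppose that a solution is
small on the compact part and equals `c ≠ 0` at the vertex. On a half-line the conserved energy is
zero, so the outgoing slope is `± c √(1 - (2/p)|c|^(p-2))`. On bounded edges the equation is nearly
linear: a pendant contributes about `-c tanh ℓ` to the Kirchhoff sum and a loop about `-2c tanh
(ℓ/2)`, with errors `O(|c|^(p-1))`. Dividing by `c` and letting `c → 0` would force the sum of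
hyperbolic tangents to be `2j - H`, where `j` counts the plus signs, and this is excluded. If `c =
0`, the solution vanishes identically. -/

noncomputable section

open Filter Topology intervalIntegral
open scoped NNReal

/-! ### Edges as intervals, primitives and integration by parts. -/

/-- The intervals that occur as edges: a half-line, or a bounded interval starting at `0`. -/
def IsEdgeInterval (I : Set ℝ) : Prop := I = Ici 0 ∨ ∃ l, 0 < l ∧ I = Icc 0 l

namespace IsEdgeInterval

variable {I : Set ℝ}

theorem Icc_subset (hI : IsEdgeInterval I) {x : ℝ} (hx : x ∈ I) : Icc 0 x ⊆ I := by
  rcases hI with rfl | ⟨l, hl, rfl⟩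
  · exact fun y hy => hy.1
  · exact fun y hy => ⟨hy.1, hy.2.trans hx.2⟩

theorem nonneg (hI : IsEdgeInterval I) {x : ℝ} (hx : x ∈ I) : 0 ≤ x := by
  rcases hI with rfl | ⟨l, hl, rfl⟩
  · exact hx
  · exact hx.1

theorem zero_mem (hI : IsEdgeInterval I) : (0 : ℝ) ∈ I := by
  rcases hI with rfl | ⟨l, hl, rfl⟩
  · exact self_mem_Ici
  · exact ⟨le_rfl, hl.le⟩

theorem exists_pos_mem (hI : IsEdgeInterval I) : ∃ d ∈ I, 0 < d := by
  rcases hI with rfl | ⟨l, hl, rfl⟩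
  · exact ⟨1, by simp, one_pos⟩
  · exact ⟨l, ⟨hl.le, le_rfl⟩, hl⟩

theorem measurableSet (hI : IsEdgeInterval I) : MeasurableSet I := by
  rcases hI with rfl | ⟨l, hl, rfl⟩
  · exact measurableSet_Ici
  · exact measurableSet_Icc

theorem ordConnected (hI : IsEdgeInterval I) : OrdConnected I := by
  rcases hI with rfl | ⟨l, hl, rfl⟩
  · exact ordConnected_Ici
  · exact ordConnected_Icc

theorem ordConnected_interior (hI : IsEdgeInterval I) : OrdConnected (interior I) := by
  rcases hI with rfl | ⟨l, hl, rfl⟩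
  · rw [interior_Ici]; exact ordConnected_Ioi
  · rw [interior_Icc]; exact ordConnected_Ioo

theorem interior_nonempty (hI : IsEdgeInterval I) : (interior I).Nonempty := by
  rcases hI with rfl | ⟨l, hl, rfl⟩
  · rw [interior_Ici]; exact ⟨1, mem_Ioi.2 one_pos⟩
  · rw [interior_Icc]; exact nonempty_Ioo.2 hl

theorem zero_notMem_interior (hI : IsEdgeInterval I) : (0 : ℝ) ∉ interior I := by
  rcases hI with rfl | ⟨l, hl, rfl⟩
  · rw [interior_Ici]; simp
  · rw [interior_Icc]; simp

theorem interior_ae_eq (hI : IsEdgeInterval I) : interior I =ᵐ[volume] I := by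
  rcases hI with rfl | ⟨l, hl, rfl⟩
  · rw [interior_Ici]; exact Ioi_ae_eq_Ici
  · rw [interior_Icc]; exact Ioo_ae_eq_Icc

/-- A compact subset of the interior is contained in a compact subinterval of the interior. -/
theorem exists_Icc_of_isCompact (hI : IsEdgeInterval I) {K : Set ℝ} (hK : IsCompact K)
    (hKI : K ⊆ interior I) : ∃ a b, K ⊆ Icc a b ∧ Icc a b ⊆ interior I := by
  rcases K.eq_empty_or_nonempty with rfl | hne
  · exact ⟨1, 0, by simp, by simp⟩
  · obtain ⟨a, ha⟩ := hK.exists_isLeast hne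
    obtain ⟨b, hb⟩ := hK.exists_isGreatest hne
    exact ⟨a, b, fun x hx => ⟨ha.2 hx, hb.2 hx⟩,
      hI.ordConnected_interior.out (hKI ha.1) (hKI hb.1)⟩

/-- For a compact subset `K` of the interior there is a point of `I` to the right of `K`. -/
theorem exists_right_of_isCompact (hI : IsEdgeInterval I) {K : Set ℝ} (hK : IsCompact K)
    (hKI : K ⊆ interior I) : ∃ b ∈ I, ∀ x ∈ K, x < b := by
  rcases hI with rfl | ⟨l, hl, rfl⟩
  · obtain ⟨b, hb⟩ := hK.bddAbove
    refine ⟨max b 0 + 1, by simp; positivity, fun x hx => ?_⟩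
    have := hb hx
    have := le_max_left b 0
    linarith
  · rw [interior_Icc] at hKI
    exact ⟨l, ⟨hl.le, le_rfl⟩, fun x hx => (hKI hx).2⟩

theorem intervalIntegrable (hI : IsEdgeInterval I) {g : ℝ → ℝ}
    (hg : MemLp g 2 (volume.restrict I)) {x y : ℝ} (hx : x ∈ I) (hy : y ∈ I) :
    IntervalIntegrable g volume x y := by
  have hsub : uIcc x y ⊆ I := hI.ordConnected.uIcc_subset hx hy
  have h : MemLp g 2 (volume.restrict (uIcc x y)) := hg.mono_measure (Measure.restrict_mono hsub le_rfl)
  have : IsFiniteMeasure (volume.restrict (uIcc x y)) :=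
    ⟨by simp⟩
  have h1 : IntegrableOn g (uIcc x y) := h.integrable one_le_two
  exact h1.intervalIntegrable

end IsEdgeInterval

/-- Integration by parts for two primitives. -/
theorem mul_sub_mul_eq_integral_of_primitive {u g w h : ℝ → ℝ} {b : ℝ} (hb : 0 ≤ b)
    (hg : IntervalIntegrable g volume 0 b) (hh : IntervalIntegrable h volume 0 b)
    (hu : ∀ x ∈ Icc 0 b, u x = u 0 + ∫ t in (0 : ℝ)..x, g t)
    (hw : ∀ x ∈ Icc 0 b, w x = w 0 + ∫ t in (0 : ℝ)..x, h t) :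
    u b * w b - u 0 * w 0 = ∫ x in (0 : ℝ)..b, (g x * w x + u x * h x) := by
  have key : ∀ {u g : ℝ → ℝ}, IntervalIntegrable g volume 0 b →
      AbsolutelyContinuousOnInterval (fun x => u 0 + ∫ t in (0 : ℝ)..x, g t) 0 b ∧
      ∀ᵐ x, x ∈ uIcc 0 b → deriv (fun x => u 0 + ∫ t in (0 : ℝ)..x, g t) x = g x := by
    intro u g hg
    constructor
    · refine AbsolutelyContinuousOnInterval.add ?_
        (hg.absolutelyContinuousOnInterval_intervalIntegral left_mem_uIcc)
      exact (LipschitzWith.const (u 0)).lipschitzOnWith.absolutelyContinuousOnInterval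
    · filter_upwards [hg.ae_hasDerivAt_integral] with x hx hxm
      exact ((hx hxm 0 left_mem_uIcc).const_add (u 0)).deriv
  obtain ⟨hU, hU'⟩ := key (u := u) hg
  obtain ⟨hW, hW'⟩ := key (u := w) hh
  have := hU.integral_deriv_mul_eq_sub hW
  rw [hu b ⟨hb, le_rfl⟩, hw b ⟨hb, le_rfl⟩]
  simp only [integral_same, add_zero] at this
  rw [← this]
  refine intervalIntegral.integral_congr_ae ?_
  filter_upwards [hU', hW'] with x h1 h2 hx
  have hx' := uIoc_subset_uIcc hx
  rw [h1 hx', h2 hx']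
  rw [uIcc_of_le hb] at hx'
  simp only [← hu x hx', ← hw x hx']

/-- `u` is a square integrable primitive of the square integrable function `g` on `I`. -/
structure H1Pair (I : Set ℝ) (u g : ℝ → ℝ) : Prop where
  memLp : MemLp u 2 (volume.restrict I)
  memLp_deriv : MemLp g 2 (volume.restrict I)
  eq_integral : ∀ x ∈ I, u x = u 0 + ∫ t in (0 : ℝ)..x, g t

namespace H1Pair

variable {I : Set ℝ} {u g w h : ℝ → ℝ}

theorem continuousOn (hI : IsEdgeInterval I) (H : H1Pair I u g) : ContinuousOn u I := by
  have hloc : ∀ b ∈ I, ContinuousOn u (Icc 0 b) := by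
    intro b hb
    have h0 := hI.nonneg hb
    have := continuousOn_primitive_interval (f := g) (μ := volume) (a := 0) (b := b)
      (by
        have := hI.intervalIntegrable H.memLp_deriv hI.zero_mem hb
        exact (intervalIntegrable_iff' (by simp)).1 this)
    rw [uIcc_of_le h0] at this
    exact (this.const_add (u 0)).congr fun x hx => H.eq_integral x (hI.Icc_subset hb hx)
  rcases hI with rfl | ⟨l, hl, rfl⟩
  · intro x hx
    have := hloc (x + 1) (by simp at hx ⊢; linarith) x ⟨hx, by linarith⟩
    refine this.mono_of_mem_nhdsWithin ?_
    rw [← Ici_inter_Iic]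
    exact inter_mem self_mem_nhdsWithin (mem_nhdsWithin_of_mem_nhds (Iic_mem_nhds (by linarith)))
  · exact hloc l ⟨hl.le, le_rfl⟩

theorem mul_sub_mul (hI : IsEdgeInterval I) (H : H1Pair I u g) (K : H1Pair I w h) {b : ℝ}
    (hb : b ∈ I) : u b * w b - u 0 * w 0 = ∫ x in (0 : ℝ)..b, (g x * w x + u x * h x) :=
  mul_sub_mul_eq_integral_of_primitive (hI.nonneg hb)
    (hI.intervalIntegrable H.memLp_deriv hI.zero_mem hb)
    (hI.intervalIntegrable K.memLp_deriv hI.zero_mem hb)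
    (fun x hx => H.eq_integral x (hI.Icc_subset hb hx))
    (fun x hx => K.eq_integral x (hI.Icc_subset hb hx))

theorem integrable_mul_add_mul (H : H1Pair I u g) (K : H1Pair I w h) :
    IntegrableOn (fun x => g x * w x + u x * h x) I :=
  (H.memLp_deriv.integrable_mul K.memLp).add (H.memLp.integrable_mul K.memLp_deriv)

theorem integral_Icc {l : ℝ} (hl : 0 < l) (H : H1Pair (Icc 0 l) u g) (K : H1Pair (Icc 0 l) w h) :
    ∫ x in Icc 0 l, (g x * w x + u x * h x) = u l * w l - u 0 * w 0 := by
  rw [H.mul_sub_mul (Or.inr ⟨l, hl, rfl⟩) K ⟨hl.le, le_rfl⟩, integral_Icc_eq_integral_Ioc,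
    intervalIntegral.integral_of_le hl.le]

/-- Since `(u w)' = g w + u h` is integrable, `u w` has a limit at infinity; since `u w` is itself
integrable, that limit is zero. -/
theorem integral_Ici (H : H1Pair (Ici 0) u g) (K : H1Pair (Ici 0) w h) :
    ∫ x in Ici 0, (g x * w x + u x * h x) = - (u 0 * w 0) := by
  have hint := (H.integrable_mul_add_mul K)
  rw [integrableOn_Ici_iff_integrableOn_Ioi] at hint
  have hlim := intervalIntegral_tendsto_integral_Ioi 0 hint tendsto_id
  have hlim2 : Tendsto (fun b => u b * w b) atTop
      (𝓝 ((∫ x in Ioi 0, (g x * w x + u x * h x)) + u 0 * w 0)) := by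
    refine (hlim.add_const (u 0 * w 0)).congr' ?_
    filter_upwards [eventually_ge_atTop 0] with b hb
    rw [id, ← H.mul_sub_mul (Or.inl rfl) K hb]
    ring
  have hI : IntegrableOn (fun x => u x * w x) (Ici 0) := H.memLp.integrable_mul K.memLp
  have h0 : (∫ x in Ioi 0, (g x * w x + u x * h x)) + u 0 * w 0 = 0 := by
    by_contra hne
    have hev := (hlim2.norm).eventually (lt_mem_nhds (half_lt_self (norm_pos_iff.2 hne)))
    obtain ⟨a, ha⟩ := (eventually_atTop.1 hev)
    set m := ‖(∫ x in Ioi 0, (g x * w x + u x * h x)) + u 0 * w 0‖ / 2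
    have hm : 0 < m := half_pos (norm_pos_iff.2 hne)
    have h1 : IntegrableOn (fun _ : ℝ => m) (Ici (max a 0)) := by
      refine Integrable.mono (hI.mono_set (Ici_subset_Ici.2 (le_max_right a 0)))
        aestronglyMeasurable_const ?_
      refine (ae_restrict_iff' measurableSet_Ici).2 (Eventually.of_forall fun x hx => ?_)
      rw [Real.norm_of_nonneg hm.le]
      exact (ha x ((le_max_left a 0).trans hx)).le
    rw [integrableOn_const_iff] at h1
    simp [hm.ne'] at h1
  rw [integral_Ici_eq_integral_Ioi]
  linarith

end H1Pair

/-! ### Weak derivatives and primitives. -/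

/-- A function that vanishes off the support of a test function has the same integral over `I` and
over a suitable initial segment of `I`. -/
theorem IsEdgeInterval.exists_setIntegral_eq {I : Set ℝ} (hI : IsEdgeInterval I) {φ : ℝ → ℝ}
    (hφ : HasCompactSupport φ) (hφI : tsupport φ ⊆ interior I) :
    φ 0 = 0 ∧ ∃ b ∈ I, φ b = 0 ∧ ∀ F : ℝ → ℝ, (∀ x, x ∉ tsupport φ → F x = 0) →
      ∫ x in I, F x = ∫ x in (0 : ℝ)..b, F x := by
  refine ⟨image_eq_zero_of_notMem_tsupport fun h => hI.zero_notMem_interior (hφI h), ?_⟩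
  obtain ⟨b, hb, hlt⟩ := hI.exists_right_of_isCompact hφ hφI
  refine ⟨b, hb, image_eq_zero_of_notMem_tsupport fun h => lt_irrefl _ (hlt b h), fun F hF => ?_⟩
  rw [intervalIntegral.integral_of_le (hI.nonneg hb), ← integral_Icc_eq_integral_Ioc]
  refine (setIntegral_eq_of_subset_of_forall_sdiff_eq_zero hI.measurableSet (hI.Icc_subset hb) ?_)
  intro x hx
  refine hF x fun hxs => hx.2 ⟨hI.nonneg hx.1, (hlt x hxs).le⟩

theorem deriv_eq_zero_of_notMem_tsupport {φ : ℝ → ℝ} {x : ℝ} (hx : x ∉ tsupport φ) :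
    deriv φ x = 0 :=
  image_eq_zero_of_notMem_tsupport fun h => hx (tsupport_deriv_subset h)

theorem primitive_deriv {φ : ℝ → ℝ} (hφ : ContDiff ℝ ∞ φ) (x : ℝ) :
    φ x = φ 0 + ∫ t in (0 : ℝ)..x, deriv φ t := by
  have hd : Continuous (deriv φ) := hφ.continuous_deriv (by simp)
  rw [integral_deriv_eq_sub (fun t _ => hφ.differentiable (by simp) t)
    (hd.intervalIntegrable 0 x)]
  ring

/-- A primitive of `g` has the weak derivative `g`. -/
theorem isWeakDerivOn_of_primitive {I : Set ℝ} (hI : IsEdgeInterval I) {u g : ℝ → ℝ}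
    (hg : MemLp g 2 (volume.restrict I))
    (hu : ∀ x ∈ I, u x = u 0 + ∫ t in (0 : ℝ)..x, g t) : IsWeakDerivOn I u g := by
  intro φ hφ hc hs
  obtain ⟨h0, b, hb, hφb, hF⟩ := hI.exists_setIntegral_eq hc hs
  have hd : Continuous (deriv φ) := hφ.continuous_deriv (by simp)
  have h := mul_sub_mul_eq_integral_of_primitive (u := u) (w := φ) (hI.nonneg hb)
    (hI.intervalIntegrable hg hI.zero_mem hb) (hd.intervalIntegrable 0 b)
    (fun x hx => hu x (hI.Icc_subset hb hx)) (fun x _ => primitive_deriv hφ x)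
  have hgi := hI.intervalIntegrable hg hI.zero_mem hb
  have huc : ContinuousOn u (uIcc 0 b) := by
    have := continuousOn_primitive_interval (f := g) (μ := volume) (a := 0) (b := b)
      ((intervalIntegrable_iff' (by simp)).1 hgi)
    refine (this.const_add (u 0)).congr fun x hx => hu x (hI.Icc_subset hb ?_)
    rwa [uIcc_of_le (hI.nonneg hb)] at hx
  rw [h0, hφb, intervalIntegral.integral_add (hgi.mul_continuousOn hφ.continuous.continuousOn)
    ((hd.intervalIntegrable 0 b).continuousOn_mul huc)] at h
  rw [hF (fun x => u x * deriv φ x) (fun x hx => by simp [deriv_eq_zero_of_notMem_tsupport hx]),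
    hF (fun x => g x * φ x) (fun x hx => by simp [image_eq_zero_of_notMem_tsupport hx])]
  linarith

theorem MeasureTheory.MemLp.integrable_mul_of_hasCompactSupport {μ : Measure ℝ}
    [IsFiniteMeasureOnCompacts μ] {f φ : ℝ → ℝ} (hf : MemLp f 2 μ) (hφ : Continuous φ)
    (hc : HasCompactSupport φ) : Integrable (fun x => f x * φ x) μ :=
  MemLp.integrable_mul (p := 2) (q := 2) hf (hφ.memLp_of_hasCompactSupport hc)

/-- The primitive of a smooth function with integral zero and compact support in the interior of
an edge is a test function. -/
theorem IsEdgeInterval.primitive_test {I : Set ℝ} (hI : IsEdgeInterval I) {ψ : ℝ → ℝ}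
    (hψ : ContDiff ℝ ∞ ψ) (hc : HasCompactSupport ψ) (hs : tsupport ψ ⊆ interior I)
    (h0 : ∫ x, ψ x = 0) : ∃ φ : ℝ → ℝ, ContDiff ℝ ∞ φ ∧ HasCompactSupport φ ∧
      tsupport φ ⊆ interior I ∧ deriv φ = ψ := by
  obtain ⟨a, b, hab, habI⟩ := hI.exists_Icc_of_isCompact hc hs
  have hz : ∀ x, x ∉ Icc a b → ψ x = 0 := fun x hx =>
    image_eq_zero_of_notMem_tsupport fun h => hx (hab h)
  have hder : ∀ x, HasDerivAt (fun x => ∫ t in a..x, ψ t) (ψ x) x := fun x =>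
    integral_hasDerivAt_right (hψ.continuous.intervalIntegrable _ _)
      (hψ.continuous.stronglyMeasurableAtFilter _ _) hψ.continuous.continuousAt
  have hd : deriv (fun x => ∫ t in a..x, ψ t) = ψ := funext fun x => (hder x).deriv
  -- To the left of `a` there is nothing to integrate; to the right of `b` the whole integral of `ψ`
  -- has been collected, and it is zero.
  have hvan : ∀ x, x ∉ Icc a b → ∫ t in a..x, ψ t = 0 := by
    intro x hx
    rcases lt_or_ge x a with hxa | hxa
    · rw [integral_symm, intervalIntegral.integral_of_le hxa.le,
        ← integral_Icc_eq_integral_Ioc, integral_Icc_eq_integral_Ico]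
      rw [setIntegral_eq_zero_of_forall_eq_zero fun t ht => hz t fun h => absurd ht.2 (not_lt.2 h.1)]
      simp
    · have hxb : b < x := by
        by_contra hcon
        exact hx ⟨hxa, not_lt.1 hcon⟩
      rw [intervalIntegral.integral_of_le hxa, ← integral_Icc_eq_integral_Ioc, ← h0]
      refine setIntegral_eq_integral_of_forall_compl_eq_zero fun t ht => hz t fun h => ht
        ⟨h.1, h.2.trans hxb.le⟩
  have hts : tsupport (fun x => ∫ t in a..x, ψ t) ⊆ Icc a b :=
    closure_minimal (fun x hx => by
      by_contra hcon
      exact hx (hvan x hcon)) isClosed_Icc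
  refine ⟨fun x => ∫ t in a..x, ψ t, ?_, ?_, hts.trans habI, hd⟩
  · rw [contDiff_infty_iff_deriv]
    exact ⟨fun x => (hder x).differentiableAt, by rw [hd]; exact hψ⟩
  · exact HasCompactSupport.of_support_subset_isCompact isCompact_Icc (subset_closure.trans hts)

theorem IsEdgeInterval.ae_restrict_interior {I : Set ℝ} (hI : IsEdgeInterval I) {P : ℝ → Prop}
    (h : ∀ᵐ x, x ∈ interior I → P x) : ∀ᵐ x ∂volume.restrict I, P x := by
  rw [← Measure.restrict_congr_set hI.interior_ae_eq]
  exact (ae_restrict_iff' isOpen_interior.measurableSet).2 h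

/-- The fundamental lemma of the calculus of variations on an edge. -/
theorem IsEdgeInterval.ae_eq_zero {I : Set ℝ} (hI : IsEdgeInterval I) {f : ℝ → ℝ}
    (hf : LocallyIntegrable f (volume.restrict I))
    (h : ∀ φ : ℝ → ℝ, ContDiff ℝ ∞ φ → HasCompactSupport φ → tsupport φ ⊆ interior I →
      ∫ x in I, f x * φ x = 0) : f =ᵐ[volume.restrict I] 0 := by
  refine hI.ae_restrict_interior (isOpen_interior.ae_eq_zero_of_integral_contDiff_smul_eq_zero
    ?_ ?_)
  · rw [locallyIntegrableOn_iff isOpen_interior.isLocallyClosed]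
    intro k hk hkc
    have := hf.integrableOn_isCompact hkc
    rwa [IntegrableOn, Measure.restrict_restrict hkc.measurableSet,
      inter_eq_left.2 (hk.trans interior_subset)] at this
  · intro φ hφ hc hs
    rw [← h φ hφ hc hs, ← setIntegral_eq_integral_of_forall_compl_eq_zero (s := I)]
    · exact setIntegral_congr_fun hI.measurableSet fun x _ => by simp [mul_comm]
    · intro x hx
      rw [image_eq_zero_of_notMem_tsupport fun h => hx (interior_subset (hs h)), zero_smul]

/-- A function with a weak derivative is a primitive of it. -/
theorem IsWeakDerivOn.exists_primitive {I : Set ℝ} (hI : IsEdgeInterval I) {f g : ℝ → ℝ}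
    (hf : MemLp f 2 (volume.restrict I)) (hg : MemLp g 2 (volume.restrict I))
    (hw : IsWeakDerivOn I f g) :
    ∃ C : ℝ, f =ᵐ[volume.restrict I] fun x => C + ∫ t in (0 : ℝ)..x, g t := by
  have hgI : ∀ a b, IntervalIntegrable (I.indicator g) volume a b := by
    intro a b
    have h1 : MemLp (I.indicator g) 2 volume := (memLp_indicator_iff_restrict hI.measurableSet).2 hg
    exact ((h1.locallyIntegrable one_le_two).integrableOn_isCompact isCompact_uIcc).intervalIntegrable
  -- Extending `g` by zero off `I` makes the primitive continuous on all of `ℝ`.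
  set G : ℝ → ℝ := fun x => ∫ t in (0 : ℝ)..x, I.indicator g t with hG
  have hGc : Continuous G := continuous_primitive hgI 0
  have hGI : ∀ x ∈ I, G x = ∫ t in (0 : ℝ)..x, g t := by
    intro x hx
    refine integral_congr fun t ht => ?_
    rw [uIcc_of_le (hI.nonneg hx)] at ht
    exact indicator_of_mem (hI.Icc_subset hx ht) g
  have hwG : IsWeakDerivOn I G g := isWeakDerivOn_of_primitive hI hg fun x hx => by
    rw [hGI x hx]
    simp [hG]
  have hdiff : ∀ φ : ℝ → ℝ, ContDiff ℝ ∞ φ → HasCompactSupport φ → tsupport φ ⊆ interior I →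
      ∫ x in I, (f x - G x) * deriv φ x = 0 := by
    intro φ hφ hc hs
    have hd : Continuous (deriv φ) := hφ.continuous_deriv (by simp)
    have hGd : Integrable (fun x => G x * deriv φ x) (volume.restrict I) :=
      (hGc.mul hd).integrable_of_hasCompactSupport hc.deriv.mul_left
    simp only [sub_mul]
    rw [integral_sub (hf.integrable_mul_of_hasCompactSupport hd hc.deriv)
      hGd,
      hw φ hφ hc hs, hwG φ hφ hc hs, sub_self]
  -- The argument of du Bois-Reymond: with a bump `ψ₀` of integral one, `ψ - (∫ ψ) ψ₀` is the
  -- derivative of a test function, and `f - G` annihilates such derivatives. Hence `f - G` acts on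
  -- `ψ` as the constant `C`.
  obtain ⟨x₀, hx₀⟩ := hI.interior_nonempty
  obtain ⟨ε, hε, hball⟩ := Metric.isOpen_iff.1 (isOpen_interior (s := I)) x₀ hx₀
  let B : ContDiffBump x₀ := ⟨ε / 4, ε / 2, by positivity, by linarith⟩
  set ψ₀ : ℝ → ℝ := B.normed volume with hψ₀
  have hψ₀s : tsupport ψ₀ ⊆ interior I := by
    rw [hψ₀, B.tsupport_normed_eq]
    exact (Metric.closedBall_subset_ball (by change ε / 2 < ε; linarith)).trans hball
  have hψ₀c : HasCompactSupport ψ₀ := B.hasCompactSupport_normed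
  have hψ₀d : ContDiff ℝ ∞ ψ₀ := B.contDiff_normed
  have hψ₀1 : ∫ x, ψ₀ x = 1 := B.integral_normed
  set C := ∫ x in I, (f x - G x) * ψ₀ x with hC
  have hint : ∀ ψ : ℝ → ℝ, Continuous ψ → HasCompactSupport ψ →
      Integrable (fun x => (f x - G x) * ψ x) (volume.restrict I) := by
    intro ψ hψ hc
    simp only [sub_mul]
    exact (hf.integrable_mul_of_hasCompactSupport hψ hc).sub
      ((hGc.mul hψ).integrable_of_hasCompactSupport hc.mul_left)
  refine ⟨C, ?_⟩
  have hzero : (fun x => f x - G x - C) =ᵐ[volume.restrict I] 0 := by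
    refine hI.ae_eq_zero ?_ ?_
    · exact ((hf.locallyIntegrable one_le_two).sub hGc.locallyIntegrable).sub
        continuous_const.locallyIntegrable
    · intro ψ hψ hc hs
      have hψI : ∫ x in I, ψ x = ∫ x, ψ x :=
        setIntegral_eq_integral_of_forall_compl_eq_zero fun x hx =>
          image_eq_zero_of_notMem_tsupport fun h => hx (interior_subset (hs h))
      have hc' : HasCompactSupport (fun x => (∫ y, ψ y) * ψ₀ x) := hψ₀c.mul_left
      have hi' : Integrable (fun x => (∫ y, ψ y) * ψ₀ x) volume :=
        (continuous_const.mul hψ₀d.continuous).integrable_of_hasCompactSupport hc'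
      obtain ⟨φ, h1, h2, h3, h4⟩ := hI.primitive_test (ψ := fun x => ψ x - (∫ y, ψ y) * ψ₀ x)
        (hψ.sub (contDiff_const.mul hψ₀d)) (hc.sub hc')
        ((tsupport_sub _ _).trans (union_subset hs
          ((tsupport_mul_subset_right).trans hψ₀s)))
        (by
          rw [integral_sub (hψ.continuous.integrable_of_hasCompactSupport hc)
            hi',
            MeasureTheory.integral_const_mul, hψ₀1]
          ring)
      have h5 := hdiff φ h1 h2 h3
      simp only [h4] at h5
      have h6 : ∫ x in I, (f x - G x) * (ψ x - (∫ y, ψ y) * ψ₀ x) =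
          (∫ x in I, (f x - G x) * ψ x) - (∫ y, ψ y) * C := by
        rw [hC, ← MeasureTheory.integral_const_mul, ← integral_sub (hint ψ hψ.continuous hc)
          ((hint ψ₀ hψ₀d.continuous hψ₀c).const_mul _)]
        congr 1; ext x; ring
      have h7 : ∫ x in I, (f x - G x - C) * ψ x =
          (∫ x in I, (f x - G x) * ψ x) - C * ∫ x in I, ψ x := by
        rw [← MeasureTheory.integral_const_mul, ← integral_sub (hint ψ hψ.continuous hc)
          ((hψ.continuous.integrable_of_hasCompactSupport hc).const_mul _)]
        congr 1; ext x; ring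
      rw [h7, hψI]
      linarith
  filter_upwards [hzero, ae_restrict_mem hI.measurableSet] with x hx hxI
  have : f x - G x - C = 0 := hx
  rw [← hGI x hxI]
  linarith

/-- Two functions that are continuous on an edge and agree almost everywhere agree everywhere. -/
theorem IsEdgeInterval.eqOn_of_ae_eq {I : Set ℝ} (hI : IsEdgeInterval I) {u w : ℝ → ℝ}
    (hu : ContinuousOn u I) (hw : ContinuousOn w I) (h : u =ᵐ[volume.restrict I] w) :
    EqOn u w I := by
  refine Measure.eqOn_of_ae_eq h hu hw ?_
  rcases hI with rfl | ⟨l, hl, rfl⟩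
  · rw [interior_Ici, closure_Ioi]
  · rw [interior_Icc, closure_Ioo hl.ne]

/-- Continuity selects the representative: the primitive formula holds almost everywhere, and both
sides are continuous on the edge. -/
theorem H1Pair.of_isWeakDerivOn {I : Set ℝ} (hI : IsEdgeInterval I) {u g : ℝ → ℝ}
    (hc : ContinuousOn u I)
    (hu : MemLp u 2 (volume.restrict I)) (hg : MemLp g 2 (volume.restrict I))
    (hw : IsWeakDerivOn I u g) : H1Pair I u g := by
  obtain ⟨C, hC⟩ := hw.exists_primitive hI hu hg
  have hP : ContinuousOn (fun x => C + ∫ t in (0 : ℝ)..x, g t) I := by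
    have hK : H1Pair I (fun x => C + ∫ t in (0 : ℝ)..x, g t) g :=
      ⟨(memLp_congr_ae hC).1 hu, hg, fun x _ => by simp⟩
    exact hK.continuousOn hI
  have he := hI.eqOn_of_ae_eq hc hP hC
  refine ⟨hu, hg, fun x hx => ?_⟩
  rw [he hx, he hI.zero_mem]
  simp

theorem MemH1On.h1Pair {I : Set ℝ} (hI : IsEdgeInterval I) {u : ℝ → ℝ} (hc : ContinuousOn u I)
    (hu : MemH1On I u) : H1Pair I u (weakDerivOn I u) :=
  .of_isWeakDerivOn hI hc hu.1 (weakDerivOn_spec hu).1 (weakDerivOn_spec hu).2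

theorem H1Pair.memH1On {I : Set ℝ} (hI : IsEdgeInterval I) {u g : ℝ → ℝ} (H : H1Pair I u g) :
    MemH1On I u :=
  ⟨H.memLp, g, H.memLp_deriv, isWeakDerivOn_of_primitive hI H.memLp_deriv H.eq_integral⟩

/-- Uniqueness of the weak derivative; it allows the chosen `weakDerivOn` to be replaced by any
explicit derivative inside integrals. -/
theorem H1Pair.weakDerivOn_ae_eq {I : Set ℝ} (hI : IsEdgeInterval I) {u g : ℝ → ℝ}
    (H : H1Pair I u g) : weakDerivOn I u =ᵐ[volume.restrict I] g := by
  have hm := H.memH1On hI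
  obtain ⟨h1, h2⟩ := weakDerivOn_spec hm
  have h3 := isWeakDerivOn_of_primitive hI H.memLp_deriv H.eq_integral
  have hz : weakDerivOn I u - g =ᵐ[volume.restrict I] 0 := by
    refine hI.ae_eq_zero ((h1.sub H.memLp_deriv).locallyIntegrable one_le_two)
      fun φ hφ hc hs => ?_
    simp only [Pi.sub_apply, sub_mul]
    rw [integral_sub (h1.integrable_mul_of_hasCompactSupport hφ.continuous hc)
      (H.memLp_deriv.integrable_mul_of_hasCompactSupport hφ.continuous hc)]
    have := h2 φ hφ hc hs
    have := h3 φ hφ hc hs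
    linarith
  filter_upwards [hz] with x hx
  exact sub_eq_zero.1 hx

/-! ### The nonlinearity. -/

/-- The nonlinearity `u - |u|^(p-2) u` of the stationary equation `u'' = u - |u|^(p-2) u`. -/
def nonlin (p : ℝ) (x : ℝ) : ℝ := x - |x| ^ (p - 2) * x

section Nonlin

variable {p : ℝ}

theorem nonlin_zero : nonlin p 0 = 0 := by simp [nonlin]

/-- At the origin the difference quotient is `|x|^q`, which tends to zero because `q > 0`; elsewhere
the product rule applies. -/
theorem hasDerivAt_abs_rpow_mul_self {q : ℝ} (hq : 0 < q) (x : ℝ) :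
    HasDerivAt (fun x => |x| ^ q * x) ((q + 1) * |x| ^ q) x := by
  rcases eq_or_ne x 0 with rfl | hx
  · rw [hasDerivAt_iff_tendsto_slope]
    have h1 : Tendsto (fun x : ℝ => |x| ^ q) (𝓝[≠] 0) (𝓝 ((q + 1) * |0| ^ q)) := by
      have : Continuous fun x : ℝ => |x| ^ q := continuous_abs.rpow_const fun _ => Or.inr hq.le
      have := (this.tendsto 0).mono_left (nhdsWithin_le_nhds (s := {0}ᶜ))
      simpa [hq.ne'] using this
    refine h1.congr' ?_
    filter_upwards [self_mem_nhdsWithin] with y hy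
    have hy' : y ≠ 0 := hy
    simp [slope_def_field, hy']
  · have h := ((hasDerivAt_abs hx).rpow_const (p := q) (Or.inl (abs_ne_zero.2 hx))).mul
      (hasDerivAt_id x)
    refine h.congr_deriv ?_
    have h2 : (SignType.sign x : ℝ) * x = |x| := sign_mul_self x
    have h3 : |x| ^ (q - 1) * |x| = |x| ^ q := by
      rw [← Real.rpow_add_one (abs_ne_zero.2 hx)]; ring_nf
    simp only [id]
    calc _ = q * (|x| ^ (q - 1) * ((SignType.sign x : ℝ) * x)) + |x| ^ q := by ring
      _ = _ := by rw [h2, h3]; ring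

theorem hasDerivAt_nonlin (hp : 2 < p) (x : ℝ) :
    HasDerivAt (nonlin p) (1 - (p - 1) * |x| ^ (p - 2)) x := by
  have h := (hasDerivAt_id x).sub (hasDerivAt_abs_rpow_mul_self (q := p - 2) (by linarith) x)
  refine h.congr_deriv ?_
  ring

theorem continuous_nonlin (hp : 2 < p) : Continuous (nonlin p) :=
  continuous_iff_continuousAt.2 fun x => (hasDerivAt_nonlin hp x).continuousAt

theorem exists_lipschitzOnWith_nonlin (hp : 2 < p) (M : ℝ) :
    ∃ K, LipschitzOnWith K (nonlin p) (Icc (-M) M) := by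
  refine ⟨(1 + (p - 1) * M ^ (p - 2)).toNNReal, (convex_Icc (-M) M).lipschitzOnWith_of_nnnorm_hasDerivWithin_le
    (fun x _ => (hasDerivAt_nonlin hp x).hasDerivWithinAt) fun x hx => ?_⟩
  have h1 : |x| ^ (p - 2) ≤ M ^ (p - 2) :=
    Real.rpow_le_rpow (abs_nonneg x) (abs_le.2 hx) (by linarith)
  have h2 : 0 ≤ |x| ^ (p - 2) := by positivity
  rw [← NNReal.coe_le_coe, coe_nnnorm, Real.norm_eq_abs]
  refine le_trans ?_ (Real.le_coe_toNNReal _)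
  rw [abs_le]
  constructor <;> nlinarith

theorem abs_nonlin_le {M x : ℝ} (hp : 2 < p) (hx : |x| ≤ M) :
    |nonlin p x| ≤ (1 + M ^ (p - 2)) * |x| := by
  have h1 : |x| ^ (p - 2) ≤ M ^ (p - 2) :=
    Real.rpow_le_rpow (abs_nonneg x) hx (by linarith)
  have h2 : 0 ≤ |x| ^ (p - 2) := by positivity
  calc |nonlin p x| ≤ |x| + |(|x| ^ (p - 2) * x)| := abs_sub _ _
    _ = (1 + |x| ^ (p - 2)) * |x| := by rw [abs_mul, abs_of_nonneg h2]; ring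
    _ ≤ _ := by gcongr

/-- Below height one the linear term dominates the power; this sign is the source of the maximum
principle. -/
theorem self_mul_nonlin_nonneg (hp : 2 < p) {x : ℝ} (hx : |x| ≤ 1) : 0 ≤ x * nonlin p x := by
  have h1 : |x| ^ (p - 2) ≤ 1 := Real.rpow_le_one (abs_nonneg x) hx (by linarith)
  have : x * nonlin p x = x ^ 2 * (1 - |x| ^ (p - 2)) := by rw [nonlin]; ring
  rw [this]
  exact mul_nonneg (sq_nonneg x) (by linarith)

theorem abs_rpow_sub_two_mul_mul_self (hp : 2 < p) (x : ℝ) :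
    |x| ^ (p - 2) * x * x = |x| ^ p := by
  rcases eq_or_ne x 0 with rfl | hx
  · simp [show p ≠ 0 by linarith]
  · rw [mul_assoc, ← sq, ← sq_abs, ← Real.rpow_natCast, ← Real.rpow_add (abs_pos.2 hx)]
    norm_num

end Nonlin

/-! ### Sobolev estimates on an edge. -/

namespace H1Pair

variable {I : Set ℝ} {u g w h : ℝ → ℝ}

theorem mul_sub_mul' (hI : IsEdgeInterval I) (H : H1Pair I u g) (K : H1Pair I w h) {a b : ℝ}
    (ha : a ∈ I) (hb : b ∈ I) :
    u b * w b - u a * w a = ∫ x in a..b, (g x * w x + u x * h x) := by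
  have hint : ∀ {x y : ℝ}, x ∈ I → y ∈ I →
      IntervalIntegrable (fun x => g x * w x + u x * h x) volume x y := by
    intro x y hx hy
    exact ((H.integrable_mul_add_mul K).mono_set
      (hI.ordConnected.uIcc_subset hx hy)).intervalIntegrable
  rw [← integral_interval_sub_left (hint hI.zero_mem hb) (hint hI.zero_mem ha),
    ← H.mul_sub_mul hI K hb, ← H.mul_sub_mul hI K ha]
  ring

theorem integrable_sq_add_sq (H : H1Pair I u g) : IntegrableOn (fun x => u x ^ 2 + g x ^ 2) I :=
  H.memLp.integrable_sq.add H.memLp_deriv.integrable_sq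

/-- Integrate `(u²)' = 2 u g` between the two points and use `2 |u g| ≤ u² + g²`. -/
theorem sq_sub_sq_le (hI : IsEdgeInterval I) (H : H1Pair I u g) {C : ℝ}
    (hC : ∫ x in I, (u x ^ 2 + g x ^ 2) ≤ C) {x y : ℝ} (hx : x ∈ I) (hy : y ∈ I) :
    u x ^ 2 ≤ u y ^ 2 + C := by
  have h1 := H.mul_sub_mul' hI H hy hx
  have h2 : |∫ t in y..x, (g t * u t + u t * g t)| ≤ C := by
    refine le_trans (norm_integral_le_integral_norm_uIoc (f := fun t => g t * u t + u t * g t)) ?_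
    refine le_trans ?_ hC
    refine le_trans (setIntegral_mono_on (g := fun x => u x ^ 2 + g x ^ 2) ?_ ?_
      measurableSet_uIoc ?_) (setIntegral_mono_set H.integrable_sq_add_sq ?_ ?_)
    · exact ((H.integrable_mul_add_mul H).mono_set
        (uIoc_subset_uIcc.trans (hI.ordConnected.uIcc_subset hy hx))).norm
    · exact H.integrable_sq_add_sq.mono_set
        (uIoc_subset_uIcc.trans (hI.ordConnected.uIcc_subset hy hx))
    · intro t _
      rw [Real.norm_eq_abs, abs_le]
      constructor <;> nlinarith [sq_nonneg (u t + g t), sq_nonneg (u t - g t)]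
    · exact Eventually.of_forall fun t => by positivity
    · exact (uIoc_subset_uIcc.trans (hI.ordConnected.uIcc_subset hy hx)).eventuallyLE
  have h3 := (abs_le.1 h2).2
  rw [← h1] at h3
  nlinarith

/-- The Sobolev inequality on an edge. -/
theorem sq_le (hI : IsEdgeInterval I) (H : H1Pair I u g) {C d : ℝ} (hd : d ∈ I) (hd0 : 0 < d)
    (hC : ∫ x in I, (u x ^ 2 + g x ^ 2) ≤ C) {x : ℝ} (hx : x ∈ I) : u x ^ 2 ≤ C / d + C := by
  have hi : IntegrableOn (fun y => u y ^ 2) (Icc 0 d) :=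
    (show IntegrableOn (fun y => u y ^ 2) I volume from H.memLp.integrable_sq).mono_set (hI.Icc_subset hd)
  -- Average `sq_sub_sq_le` over `y ∈ [0, d]`.
  have h1 : ∫ y in Icc 0 d, u x ^ 2 ≤ ∫ y in Icc 0 d, (u y ^ 2 + C) := by
    refine setIntegral_mono_on (by simp) (hi.add (by simp)) measurableSet_Icc fun y hy => ?_
    exact H.sq_sub_sq_le hI hC hx (hI.Icc_subset hd hy)
  rw [integral_add hi (by simp)] at h1
  have h2 : ∫ y in Icc 0 d, u y ^ 2 ≤ C := by
    refine le_trans ?_ hC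
    refine (setIntegral_mono_on hi (H.integrable_sq_add_sq.mono_set (hI.Icc_subset hd))
      measurableSet_Icc fun y _ => ?_).trans
      (setIntegral_mono_set H.integrable_sq_add_sq ?_ (hI.Icc_subset hd).eventuallyLE)
    · simp [sq_nonneg]
    · exact Eventually.of_forall fun t => by positivity
  simp [hd0.le] at h1
  have h3 : d * u x ^ 2 ≤ C + d * C := by linarith
  have h4 : C / d + C = (C + d * C) / d := by field_simp
  rw [h4, le_div_iff₀ hd0]
  linarith

theorem exists_bound (hI : IsEdgeInterval I) (H : H1Pair I u g) : ∃ M, ∀ x ∈ I, |u x| ≤ M := by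
  obtain ⟨d, hd, hd0⟩ := hI.exists_pos_mem
  exact ⟨_, fun x hx => Real.abs_le_sqrt (H.sq_le hI hd hd0 le_rfl hx)⟩

theorem memLp_nonlin {p : ℝ} (hp : 2 < p) (hI : IsEdgeInterval I) (H : H1Pair I u g) :
    MemLp (fun x => nonlin p (u x)) 2 (volume.restrict I) := by
  obtain ⟨M, hM⟩ := H.exists_bound hI
  refine H.memLp.of_le_mul (c := 1 + M ^ (p - 2))
    ((continuous_nonlin hp).comp_aestronglyMeasurable H.memLp.1) ?_
  refine (ae_restrict_iff' hI.measurableSet).2 (Eventually.of_forall fun x hx => ?_)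
  exact abs_nonlin_le hp (hM x hx)

/-- `|u|^p` is the product of the square integrable functions `u` and `u - nonlin p u`. -/
theorem integrable_abs_rpow {p : ℝ} (hp : 2 < p) (hI : IsEdgeInterval I) (H : H1Pair I u g) :
    IntegrableOn (fun x => |u x| ^ p) I := by
  have h := H.memLp.integrable_mul (H.memLp.sub (H.memLp_nonlin hp hI))
  refine h.congr (Eventually.of_forall fun x => ?_)
  simp only [Pi.mul_apply, Pi.sub_apply]
  rw [← abs_rpow_sub_two_mul_mul_self hp, nonlin]
  ring

/-- Right derivatives on `[0, b)` suffice for Grönwall's inequality and for the conservation law,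
and involve no values off the edge. -/
theorem hasDerivWithinAt (hI : IsEdgeInterval I) (H : H1Pair I u g) (hg : ContinuousOn g I)
    {b x : ℝ} (hb : b ∈ I) (hx : x ∈ Ico 0 b) : HasDerivWithinAt u (g x) (Ici x) x := by
  have hsub := hI.Icc_subset hb
  have hxb : x ∈ Icc 0 b := ⟨hx.1, hx.2.le⟩
  have hnhds : Icc 0 b ∈ 𝓝[>] x := by
    refine mem_of_superset (Ioc_mem_nhdsGT hx.2) fun y hy => ⟨hx.1.trans hy.1.le, hy.2⟩
  have hder : HasDerivWithinAt (fun y => ∫ t in (0 : ℝ)..y, g t) (g x) (Ici x) x := by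
    refine integral_hasDerivWithinAt_right
      (hI.intervalIntegrable H.memLp_deriv hI.zero_mem (hsub hxb)) (t := Ioi x) ?_ ?_
    · exact ⟨Icc 0 b, hnhds, ((hg.mono hsub).aestronglyMeasurable measurableSet_Icc)⟩
    · exact ((hg.mono hsub) x hxb).mono_of_mem_nhdsWithin hnhds
  refine (hder.const_add (u 0)).congr_of_eventuallyEq ?_ (H.eq_integral x (hsub hxb))
  have : Icc 0 b ∈ 𝓝[≥] x :=
    mem_of_superset (Icc_mem_nhdsGE hx.2) fun y hy => ⟨hx.1.trans hy.1, hy.2⟩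
  filter_upwards [this] with y hy
  exact H.eq_integral y (hsub hy)

end H1Pair

/-! ### The differential equation on one edge. -/

/-- `u` is an `H¹` solution of `u'' = u - |u|^(p-2) u` on the edge `I`, with derivative `v`. -/
structure IsEdgeSolution (p : ℝ) (I : Set ℝ) (u v : ℝ → ℝ) : Prop where
  left : H1Pair I u v
  right : H1Pair I v (fun x => nonlin p (u x))

namespace IsEdgeSolution

variable {p : ℝ} {I : Set ℝ} {u v u' v' : ℝ → ℝ}

theorem hasDerivWithinAt_left (hI : IsEdgeInterval I) (H : IsEdgeSolution p I u v) {b x : ℝ}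
    (hb : b ∈ I) (hx : x ∈ Ico 0 b) : HasDerivWithinAt u (v x) (Ici x) x :=
  H.left.hasDerivWithinAt hI (H.right.continuousOn hI) hb hx

theorem hasDerivWithinAt_right (hp : 2 < p) (hI : IsEdgeInterval I) (H : IsEdgeSolution p I u v)
    {b x : ℝ} (hb : b ∈ I) (hx : x ∈ Ico 0 b) :
    HasDerivWithinAt v (nonlin p (u x)) (Ici x) x :=
  H.right.hasDerivWithinAt hI ((continuous_nonlin hp).comp_continuousOn (H.left.continuousOn hI))
    hb hx

/-- Continuous dependence on the initial data. -/
theorem dist_le (hp : 2 < p) (hI : IsEdgeInterval I) (H : IsEdgeSolution p I u v)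
    (H' : IsEdgeSolution p I u' v') {M : ℝ} {K : ℝ≥0}
    (hK : LipschitzOnWith K (nonlin p) (Icc (-M) M)) (hu : ∀ x ∈ I, |u x| ≤ M)
    (hu' : ∀ x ∈ I, |u' x| ≤ M) {x : ℝ} (hx : x ∈ I) :
    dist (u x, v x) (u' x, v' x) ≤
      dist (u 0, v 0) (u' 0, v' 0) * Real.exp ((max 1 K : ℝ≥0) * x) := by
  -- The first-order system is `(u, v)' = (v, nonlin p u)`; in the maximum norm its two components
  -- have Lipschitz constants `1` and `K`.
  have hlip : LipschitzOnWith (max 1 K) (fun z : ℝ × ℝ => (z.2, nonlin p z.1))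
      {z | z.1 ∈ Icc (-M) M} := by
    refine LipschitzOnWith.prodMk (LipschitzWith.prod_snd.lipschitzOnWith) ?_
    have := hK.comp (LipschitzWith.prod_fst.lipschitzOnWith (α := ℝ × ℝ)
      (s := {z : ℝ × ℝ | z.1 ∈ Icc (-M) M})) (fun z hz => hz)
    simpa [Function.comp_def] using this
  have hsub := hI.Icc_subset hx
  have key := dist_le_of_trajectories_ODE_of_mem (a := 0) (b := x) (K := max 1 K)
    (v := fun _ z => (z.2, nonlin p z.1)) (s := fun _ => {z : ℝ × ℝ | z.1 ∈ Icc (-M) M})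
    (f := fun t => (u t, v t)) (g := fun t => (u' t, v' t)) (fun _ _ => hlip)
    (((H.left.continuousOn hI).mono hsub).prodMk ((H.right.continuousOn hI).mono hsub))
    (fun t ht => (H.hasDerivWithinAt_left hI hx ht).prodMk (H.hasDerivWithinAt_right hp hI hx ht))
    (fun t ht => abs_le.1 (hu t (hsub ⟨ht.1, ht.2.le⟩)))
    (((H'.left.continuousOn hI).mono hsub).prodMk ((H'.right.continuousOn hI).mono hsub))
    (fun t ht => (H'.hasDerivWithinAt_left hI hx ht).prodMk
      (H'.hasDerivWithinAt_right hp hI hx ht))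
    (fun t ht => abs_le.1 (hu' t (hsub ⟨ht.1, ht.2.le⟩))) le_rfl x
    ⟨hI.nonneg hx, le_rfl⟩
  simpa using key

theorem zero (p : ℝ) (I : Set ℝ) : IsEdgeSolution p I 0 0 :=
  ⟨⟨MemLp.zero, MemLp.zero, by simp⟩, ⟨MemLp.zero, by simp [nonlin_zero], by simp [nonlin_zero]⟩⟩

/-- Uniqueness for the Cauchy problem: compare with the zero solution. -/
theorem eq_zero (hp : 2 < p) (hI : IsEdgeInterval I) (H : IsEdgeSolution p I u v)
    (hu : u 0 = 0) (hv : v 0 = 0) {x : ℝ} (hx : x ∈ I) : u x = 0 := by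
  obtain ⟨M, hM⟩ := H.left.exists_bound hI
  obtain ⟨K, hK⟩ := exists_lipschitzOnWith_nonlin hp M
  have h := H.dist_le hp hI (zero p I) hK hM
    (fun y _ => by simpa using (abs_nonneg _).trans (hM x hx)) hx
  simp only [hu, hv, Pi.zero_apply, dist_self, zero_mul] at h
  have := dist_le_zero.1 h
  exact congrArg Prod.fst this

/-- Multiplying the equation by `2 u'` exhibits a first integral. -/
theorem energy_eq (hp : 2 < p) (hI : IsEdgeInterval I) (H : IsEdgeSolution p I u v) {x : ℝ}
    (hx : x ∈ I) :
    v x ^ 2 - u x ^ 2 + 2 / p * |u x| ^ p = v 0 ^ 2 - u 0 ^ 2 + 2 / p * |u 0| ^ p := by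
  have hsub := hI.Icc_subset hx
  have hcu := (H.left.continuousOn hI).mono hsub
  have hcv := (H.right.continuousOn hI).mono hsub
  have h0 := hI.nonneg hx
  refine constant_of_has_deriv_right_zero (f := fun x => v x ^ 2 - u x ^ 2 + 2 / p * |u x| ^ p)
    ?_ ?_ x ⟨h0, le_rfl⟩
  · exact ((hcv.pow 2).sub (hcu.pow 2)).add (continuousOn_const.mul
      (hcu.abs.rpow_const fun _ _ => Or.inr (by linarith)))
  · intro t ht
    have hu := H.hasDerivWithinAt_left hI hx ht
    have hv := H.hasDerivWithinAt_right hp hI hx ht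
    have ha := (hasDerivAt_abs_rpow (u t) (p := p) (by linarith)).comp_hasDerivWithinAt t hu
    refine (((hv.pow 2).sub (hu.pow 2)).add (ha.const_mul (2 / p))).congr_deriv ?_
    have hp0 : p ≠ 0 := by linarith
    rw [nonlin]
    field_simp
    ring

/-- On a half-line the energy of an `H¹` solution vanishes. -/
theorem energy_eq_zero (hp : 2 < p) (H : IsEdgeSolution p (Ici 0) u v) :
    v 0 ^ 2 - u 0 ^ 2 + 2 / p * |u 0| ^ p = 0 := by
  have hI : IsEdgeInterval (Ici 0) := Or.inl rfl
  -- The energy is constant and also integrable over a set of infinite measure, so it is zero.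
  have hint : IntegrableOn (fun x => v x ^ 2 - u x ^ 2 + 2 / p * |u x| ^ p) (Ici 0) :=
    (H.right.memLp.integrable_sq.sub H.left.memLp.integrable_sq).add
      ((H.left.integrable_abs_rpow hp hI).const_mul _)
  have h2 : IntegrableOn (fun _ : ℝ => v 0 ^ 2 - u 0 ^ 2 + 2 / p * |u 0| ^ p) (Ici 0) :=
    hint.congr_fun (fun x hx => H.energy_eq hp hI hx) measurableSet_Ici
  rw [integrableOn_const_iff] at h2
  simpa using h2

/-- `(u v)' = v² + u nonlin p u ≥ 0` while `|u| ≤ 1`; in other words, `u²` is convex. -/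
theorem mul_le_mul_of_le_one (hp : 2 < p) (hI : IsEdgeInterval I) (H : IsEdgeSolution p I u v)
    (hu : ∀ x ∈ I, |u x| ≤ 1) {x y : ℝ} (hx : x ∈ I) (hy : y ∈ I) (hxy : x ≤ y) :
    u x * v x ≤ u y * v y := by
  have h := H.left.mul_sub_mul' hI H.right hx hy
  have : 0 ≤ ∫ t in x..y, (v t * v t + u t * nonlin p (u t)) := by
    refine intervalIntegral.integral_nonneg hxy fun t ht => ?_
    exact add_nonneg (mul_self_nonneg _)
      (self_mul_nonlin_nonneg hp (hu t (hI.ordConnected.out hx hy ht)))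
  linarith

/-- A maximum principle for small solutions on pendants and loops. -/
theorem abs_le_abs_zero {l : ℝ} (hp : 2 < p) (hl : 0 < l) (H : IsEdgeSolution p (Icc 0 l) u v)
    (hu : ∀ x ∈ Icc 0 l, |u x| ≤ 1) (hend : v l = 0 ∨ u l = u 0) {x : ℝ} (hx : x ∈ Icc 0 l) :
    |u x| ≤ |u 0| := by
  have hI : IsEdgeInterval (Icc 0 l) := Or.inr ⟨l, hl, rfl⟩
  have h0 : (0 : ℝ) ∈ Icc 0 l := hI.zero_mem
  have hl' : l ∈ Icc 0 l := ⟨hl.le, le_rfl⟩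
  rw [← sq_le_sq]
  -- By convexity, `u²` decreases on `[0, x]` if `u v ≤ 0` at `x`. Otherwise it increases on `[x,
  -- l]`: on a loop `u l = u 0` then gives the bound, while at a tip `u v = 0` contradicts the
  -- monotonicity of `u v`.
  rcases le_or_gt (u x * v x) 0 with hneg | hpos
  · have h := H.left.mul_sub_mul' hI H.left h0 hx
    have : 0 ≤ ∫ t in (0 : ℝ)..x, -(v t * u t + u t * v t) := by
      refine intervalIntegral.integral_nonneg hx.1 fun t ht => ?_
      have := H.mul_le_mul_of_le_one hp hI hu ⟨ht.1, ht.2.trans hx.2⟩ hx ht.2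
      linarith
    rw [intervalIntegral.integral_neg] at this
    nlinarith
  · have hmono := H.mul_le_mul_of_le_one hp hI hu hx hl' hx.2
    rcases hend with hv | hul
    · rw [hv, mul_zero] at hmono
      linarith
    · rw [← hul]
      have h := H.left.mul_sub_mul' hI H.left hx hl'
      have : 0 ≤ ∫ t in x..l, (v t * u t + u t * v t) := by
        refine intervalIntegral.integral_nonneg hx.2 fun t ht => ?_
        have := H.mul_le_mul_of_le_one hp hI hu hx ⟨hx.1.trans ht.1, ht.2⟩ ht.1
        linarith
      nlinarith

/-- Testing the equation with a hyperbolic cosine. -/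
theorem abs_cosh_test_le {l a c : ℝ} (hp : 2 < p) (hl : 0 < l)
    (H : IsEdgeSolution p (Icc 0 l) u v) (ha : a ∈ Icc 0 l) (hu : ∀ x ∈ Icc 0 l, |u x| ≤ c) :
    |v l * Real.cosh (l - a) - u l * Real.sinh (l - a) - (v 0 * Real.cosh a + u 0 * Real.sinh a)| ≤
      c ^ (p - 2) * c * Real.cosh l * l := by
  have hI : IsEdgeInterval (Icc 0 l) := Or.inr ⟨l, hl, rfl⟩
  have hl' : l ∈ Icc 0 l := ⟨hl.le, le_rfl⟩
  have hcosh : ∀ x, HasDerivAt (fun x => Real.cosh (x - a)) (Real.sinh (x - a)) x := fun x => by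
    simpa using ((hasDerivAt_id x).sub_const a).cosh
  have hsinh : ∀ x, HasDerivAt (fun x => Real.sinh (x - a)) (Real.cosh (x - a)) x := fun x => by
    simpa using ((hasDerivAt_id x).sub_const a).sinh
  have hcc : Continuous fun x => Real.cosh (x - a) :=
    Real.continuous_cosh.comp (continuous_id.sub continuous_const)
  have hsc : Continuous fun x => Real.sinh (x - a) :=
    Real.continuous_sinh.comp (continuous_id.sub continuous_const)
  have hcp : ∀ x ∈ Icc 0 l, Real.cosh (x - a) = Real.cosh (0 - a) +
      ∫ t in (0 : ℝ)..x, Real.sinh (t - a) := fun x _ => by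
    rw [integral_eq_sub_of_hasDerivAt (fun t _ => hcosh t) (hsc.intervalIntegrable _ _)]; ring
  have hsp : ∀ x ∈ Icc 0 l, Real.sinh (x - a) = Real.sinh (0 - a) +
      ∫ t in (0 : ℝ)..x, Real.cosh (t - a) := fun x _ => by
    rw [integral_eq_sub_of_hasDerivAt (fun t _ => hsinh t) (hcc.intervalIntegrable _ _)]; ring
  have hvi := hI.intervalIntegrable H.left.memLp_deriv hI.zero_mem hl'
  have hfi := hI.intervalIntegrable H.right.memLp_deriv hI.zero_mem hl'
  have h1 := mul_sub_mul_eq_integral_of_primitive hl.le hfi (hsc.intervalIntegrable 0 l)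
    H.right.eq_integral hcp
  have h2 := mul_sub_mul_eq_integral_of_primitive hl.le hvi (hcc.intervalIntegrable 0 l)
    H.left.eq_integral hsp
  have huc : ContinuousOn u (uIcc 0 l) := by
    rw [uIcc_of_le hl.le]; exact H.left.continuousOn hI
  have hvc : ContinuousOn v (uIcc 0 l) := by
    rw [uIcc_of_le hl.le]; exact H.right.continuousOn hI
  -- Since `cosh (x - a)` solves the linear equation `w'' = w`, the linear terms cancel and only the
  -- power remains.
  have e : (∫ x in (0 : ℝ)..l, (nonlin p (u x) * Real.cosh (x - a) + v x * Real.sinh (x - a))) -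
      (∫ x in (0 : ℝ)..l, (v x * Real.sinh (x - a) + u x * Real.cosh (x - a))) =
      ∫ x in (0 : ℝ)..l, -(|u x| ^ (p - 2) * u x * Real.cosh (x - a)) := by
    rw [← intervalIntegral.integral_sub]
    · congr 1; ext x; rw [nonlin]; ring
    · exact (hfi.mul_continuousOn hcc.continuousOn).add (hvi.mul_continuousOn hsc.continuousOn)
    · exact (hvi.mul_continuousOn hsc.continuousOn).add
        ((hcc.intervalIntegrable 0 l).continuousOn_mul huc)
  have hbound : ‖∫ x in (0 : ℝ)..l, -(|u x| ^ (p - 2) * u x * Real.cosh (x - a))‖ ≤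
      (c ^ (p - 2) * c * Real.cosh l) * |l - 0| := by
    refine norm_integral_le_of_norm_le_const fun x hx => ?_
    rw [uIoc_of_le hl.le] at hx
    have hxu := hu x ⟨hx.1.le, hx.2⟩
    have hc0 : 0 ≤ c := (abs_nonneg _).trans hxu
    rw [norm_neg, Real.norm_eq_abs, abs_mul, abs_mul, abs_of_nonneg (by positivity : 0 ≤ |u x| ^ (p - 2)),
      abs_of_pos (Real.cosh_pos _)]
    have h3 : Real.cosh (x - a) ≤ Real.cosh l := by
      rw [Real.cosh_le_cosh, abs_of_pos hl, abs_le]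
      constructor <;> linarith [hx.1, hx.2, ha.1, ha.2]
    gcongr
  rw [← e, ← h1, ← h2, sub_zero, abs_of_pos hl, Real.norm_eq_abs] at hbound
  convert hbound using 2
  rw [zero_sub, Real.cosh_neg, Real.sinh_neg]
  ring

end IsEdgeSolution

/-! ### Explicit `H¹` functions used as test functions. -/

theorem H1Pair.congr_deriv {I : Set ℝ} (hI : IsEdgeInterval I) {u g g' : ℝ → ℝ}
    (H : H1Pair I u g) (h : g =ᵐ[volume.restrict I] g') : H1Pair I u g' := by
  refine ⟨H.memLp, (memLp_congr_ae h).1 H.memLp_deriv, fun x hx => ?_⟩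
  rw [H.eq_integral x hx]
  congr 1
  refine intervalIntegral.integral_congr_ae ?_
  have h' := (ae_restrict_iff' hI.measurableSet).1 h
  filter_upwards [h'] with t ht htx
  rw [uIoc_of_le (hI.nonneg hx)] at htx
  exact ht (hI.Icc_subset hx ⟨htx.1.le, htx.2⟩)

theorem H1Pair.zero (I : Set ℝ) : H1Pair I 0 0 := ⟨MemLp.zero, MemLp.zero, by simp⟩

theorem H1Pair.of_test (I : Set ℝ) {φ : ℝ → ℝ} (hφ : ContDiff ℝ ∞ φ) (hc : HasCompactSupport φ) :
    H1Pair I φ (deriv φ) :=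
  ⟨hφ.continuous.memLp_of_hasCompactSupport hc,
    (hφ.continuous_deriv (by simp)).memLp_of_hasCompactSupport hc.deriv,
    fun x _ => primitive_deriv hφ x⟩

theorem Continuous.memLp_restrict_Icc {f : ℝ → ℝ} (hf : Continuous f) (a b : ℝ) :
    MemLp f 2 (volume.restrict (Icc a b)) := by
  obtain ⟨C, hC⟩ := isCompact_Icc.exists_bound_of_continuousOn (s := Icc a b) hf.continuousOn
  exact MemLp.of_bound hf.aestronglyMeasurable C
    ((ae_restrict_iff' measurableSet_Icc).2 (Eventually.of_forall hC))

theorem H1Pair.id (l : ℝ) : H1Pair (Icc 0 l) (fun x => x) 1 :=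
  ⟨continuous_id.memLp_restrict_Icc 0 l, continuous_one.memLp_restrict_Icc 0 l, by simp⟩

theorem H1Pair.one (l : ℝ) : H1Pair (Icc 0 l) 1 0 :=
  ⟨continuous_one.memLp_restrict_Icc 0 l, MemLp.zero, by simp⟩

theorem H1Pair.exp_neg : H1Pair (Ici 0) (fun x => Real.exp (-x)) (fun x => -Real.exp (-x)) := by
  have h : MemLp (fun x : ℝ => Real.exp (-x)) 2 (volume.restrict (Ici 0)) := by
    have hc : Continuous fun x : ℝ => Real.exp (-x) := Real.continuous_exp.comp continuous_neg
    rw [memLp_two_iff_integrable_sq hc.aestronglyMeasurable]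
    have : IntegrableOn (fun x : ℝ => Real.exp (-2 * x)) (Ici 0) := by
      rw [integrableOn_Ici_iff_integrableOn_Ioi]
      exact exp_neg_integrableOn_Ioi 0 two_pos
    refine this.congr (Eventually.of_forall fun x => ?_)
    simp only [sq, ← Real.exp_add]
    ring_nf
  refine ⟨h, h.neg, fun x _ => ?_⟩
  have hd : ∀ x : ℝ, HasDerivAt (fun x => Real.exp (-x)) (-Real.exp (-x)) x := fun x => by
    simpa using (hasDerivAt_neg x).exp
  rw [integral_eq_sub_of_hasDerivAt (fun t _ => hd t)
    ((Real.continuous_exp.comp continuous_neg).neg.intervalIntegrable _ _)]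
  ring

/-! ### Bound-states as classical solutions. -/

namespace SingleKnotGraph

variable {G : SingleKnotGraph} {p : ℝ} {u v η ζ g : G.Fun}

theorem isEdgeInterval_edgeSet (e : G.Edge) : IsEdgeInterval (G.edgeSet e) := by
  rcases e with k | k | k
  · exact Or.inl rfl
  · exact Or.inr ⟨_, G.pendantLength_pos k, rfl⟩
  · exact Or.inr ⟨_, G.loopLength_pos k, rfl⟩

theorem MemH1.h1Pair (hu : G.MemH1 u) (e : G.Edge) :
    H1Pair (G.edgeSet e) (u e) (G.weakDeriv u e) :=
  (hu.2 e).h1Pair (isEdgeInterval_edgeSet e) (hu.1.1 e)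

theorem MemH1.of_h1Pair (h : ∀ e, H1Pair (G.edgeSet e) (η e) (ζ e))
    (h0 : ∀ e e', η e 0 = η e' 0)
    (hl : ∀ k : Fin G.numLoops, η (.inr (.inr k)) (G.loopLength k) = η (.inr (.inr k)) 0) :
    G.MemH1 η :=
  ⟨⟨fun e => (h e).continuousOn (isEdgeInterval_edgeSet e), h0, hl⟩,
    fun e => (h e).memH1On (isEdgeInterval_edgeSet e)⟩

/-- The weak form of the equation, computed with any representatives of the weak derivatives. -/
theorem integral_weakForm_eq (hu : ∀ e, H1Pair (G.edgeSet e) (u e) (g e))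
    (hη : ∀ e, H1Pair (G.edgeSet e) (η e) (ζ e)) :
    G.integral (fun e x => G.weakDeriv u e x * G.weakDeriv η e x + u e x * η e x
      - |u e x| ^ (p - 2) * u e x * η e x) =
    ∑ e, ∫ x in G.edgeSet e, (nonlin p (u e x) * η e x + g e x * ζ e x) := by
  refine Finset.sum_congr rfl fun e _ => integral_congr_ae ?_
  filter_upwards [(hu e).weakDerivOn_ae_eq (isEdgeInterval_edgeSet e),
    (hη e).weakDerivOn_ae_eq (isEdgeInterval_edgeSet e)] with x h1 h2
  simp only [weakDeriv]
  rw [h1, h2, nonlin]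
  ring

theorem integral_weakForm_single [DecidableEq G.Edge]
    (hu : ∀ e, H1Pair (G.edgeSet e) (u e) (g e)) {e : G.Edge} {φ ψ : ℝ → ℝ}
    (hφ : H1Pair (G.edgeSet e) φ ψ) :
    G.integral (fun e' x => G.weakDeriv u e' x * G.weakDeriv (Pi.single e φ : G.Fun) e' x
      + u e' x * (Pi.single e φ : G.Fun) e' x
      - |u e' x| ^ (p - 2) * u e' x * (Pi.single e φ : G.Fun) e' x) =
    ∫ x in G.edgeSet e, (nonlin p (u e x) * φ x + g e x * ψ x) := by
  rw [integral_weakForm_eq (ζ := Pi.single e ψ) hu]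
  · rw [Finset.sum_eq_single e]
    · simp
    · intro e' _ he'
      simp [Pi.single_eq_of_ne he']
    · simp
  · intro e'
    rcases eq_or_ne e' e with rfl | he'
    · simpa using hφ
    · rw [Pi.single_eq_of_ne he', Pi.single_eq_of_ne he']
      exact H1Pair.zero _

theorem memH1_single [DecidableEq G.Edge] {e : G.Edge} {φ ψ : ℝ → ℝ}
    (hφ : H1Pair (G.edgeSet e) φ ψ) (h0 : φ 0 = 0)
    (hl : ∀ k : Fin G.numLoops, e = .inr (.inr k) → φ (G.loopLength k) = 0) :
    G.MemH1 (Pi.single e φ : G.Fun) := by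
  have hz : ∀ e', (Pi.single e φ : G.Fun) e' 0 = 0 := by
    intro e'
    rcases eq_or_ne e' e with rfl | he'
    · simpa using h0
    · simp [Pi.single_eq_of_ne he']
  refine MemH1.of_h1Pair (ζ := Pi.single e ψ) (fun e' => ?_) (fun e' e'' => ?_) fun k => ?_
  · rcases eq_or_ne e' e with rfl | he'
    · simpa using hφ
    · rw [Pi.single_eq_of_ne he', Pi.single_eq_of_ne he']
      exact H1Pair.zero _
  · rw [hz, hz]
  · rw [hz]
    rcases eq_or_ne (.inr (.inr k)) e with h | h
    · subst h
      simpa using hl k rfl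
    · simp [Pi.single_eq_of_ne h]

/-- A classical solution on the graph: it solves the equation on every edge, is continuous at the
vertex, and satisfies the Neumann condition at the tips of the pendants and the Kirchhoff condition
at the vertex. -/
structure IsClassicalSolution (G : SingleKnotGraph) (p : ℝ) (u v : G.Fun) : Prop where
  isEdgeSolution : ∀ e, IsEdgeSolution p (G.edgeSet e) (u e) (v e)
  vertex : ∀ e e', u e 0 = u e' 0
  loop : ∀ k : Fin G.numLoops, u (.inr (.inr k)) (G.loopLength k) = u (.inr (.inr k)) 0
  neumann : ∀ k : Fin G.numPendants, v (.inr (.inl k)) (G.pendantLength k) = 0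
  kirchhoff : ∑ k, v (.inl k) 0 + ∑ k, v (.inr (.inl k)) 0
    + ∑ k, (v (.inr (.inr k)) 0 - v (.inr (.inr k)) (G.loopLength k)) = 0

/-- The integrand on each edge is the derivative of `v η`, so only boundary values survive; those at
infinity vanish. -/
theorem integral_weakForm_eq_boundary (hu : ∀ e, IsEdgeSolution p (G.edgeSet e) (u e) (v e))
    (hη : ∀ e, H1Pair (G.edgeSet e) (η e) (ζ e)) :
    G.integral (fun e x => G.weakDeriv u e x * G.weakDeriv η e x + u e x * η e x
      - |u e x| ^ (p - 2) * u e x * η e x) =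
    (∑ k, -(v (.inl k) 0 * η (.inl k) 0)) +
    ((∑ k, (v (.inr (.inl k)) (G.pendantLength k) * η (.inr (.inl k)) (G.pendantLength k)
      - v (.inr (.inl k)) 0 * η (.inr (.inl k)) 0)) +
    ∑ k, (v (.inr (.inr k)) (G.loopLength k) * η (.inr (.inr k)) (G.loopLength k)
      - v (.inr (.inr k)) 0 * η (.inr (.inr k)) 0)) := by
  rw [integral_weakForm_eq (fun e => (hu e).left) hη, Fintype.sum_sum_type, Fintype.sum_sum_type]
  congr 1
  · exact Finset.sum_congr rfl fun k _ => (hu (.inl k)).right.integral_Ici (hη (.inl k))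
  · congr 1
    · exact Finset.sum_congr rfl fun k _ =>
        (hu (.inr (.inl k))).right.integral_Icc (G.pendantLength_pos k) (hη (.inr (.inl k)))
    · exact Finset.sum_congr rfl fun k _ =>
        (hu (.inr (.inr k))).right.integral_Icc (G.loopLength_pos k) (hη (.inr (.inr k)))

theorem IsClassicalSolution.isBoundState (H : G.IsClassicalSolution p u v)
    (hne : ∃ e, ∃ x ∈ G.edgeSet e, u e x ≠ 0) : G.IsBoundState p u := by
  refine ⟨MemH1.of_h1Pair (fun e => (H.isEdgeSolution e).left) H.vertex H.loop, hne,
    fun η hη => ?_⟩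
  rw [integral_weakForm_eq_boundary H.isEdgeSolution (fun e => hη.h1Pair e)]
  have h0 : ∀ e, η e 0 = η (.inl ⟨0, G.one_le_numHalfLines⟩) 0 := fun e => hη.1.2.1 _ _
  simp only [H.neumann, hη.1.2.2, h0, zero_mul, zero_sub]
  have hk := H.kirchhoff
  set a := η (.inl ⟨0, G.one_le_numHalfLines⟩) 0
  calc _ = -(∑ k, v (.inl k) 0 + ∑ k, v (.inr (.inl k)) 0
    + ∑ k, (v (.inr (.inr k)) 0 - v (.inr (.inr k)) (G.loopLength k))) * a := by
        simp only [Finset.sum_neg_distrib, Finset.sum_sub_distrib, ← Finset.sum_mul]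
        ring
    _ = 0 := by rw [hk]; ring

/-- Regularity: test functions supported on one edge show that `u'` has weak derivative `nonlin p
u`. Hence `u'` agrees almost everywhere with a primitive of `nonlin p u`, and this primitive is `v`.
-/
theorem IsBoundState.exists_isEdgeSolution (hp : 2 < p) (H : G.IsBoundState p u) (e : G.Edge) :
    ∃ v : ℝ → ℝ, IsEdgeSolution p (G.edgeSet e) (u e) v := by
  classical
  have hI := isEdgeInterval_edgeSet e
  have hpair := fun e => H.1.h1Pair e
  have hnl := (hpair e).memLp_nonlin hp hI
  have hw : IsWeakDerivOn (G.edgeSet e) (G.weakDeriv u e) (fun x => nonlin p (u e x)) := by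
    intro φ hφ hc hs
    have hz : ∀ x, x ∉ interior (G.edgeSet e) → φ x = 0 := fun x hx =>
      image_eq_zero_of_notMem_tsupport fun h => hx (hs h)
    have hpφ := H1Pair.of_test (G.edgeSet e) hφ hc
    have h1 := H.2.2 _ (memH1_single hpφ (hz 0 hI.zero_notMem_interior) (by
      rintro k rfl
      refine hz _ ?_
      rw [edgeSet, interior_Icc]
      simp))
    rw [integral_weakForm_single hpair hpφ, MeasureTheory.integral_add
      (hnl.integrable_mul_of_hasCompactSupport hφ.continuous hc)
      ((hpair e).memLp_deriv.integrable_mul_of_hasCompactSupport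
        (hφ.continuous_deriv (by simp)) hc.deriv)] at h1
    linarith
  obtain ⟨C, hC⟩ := hw.exists_primitive hI (hpair e).memLp_deriv hnl
  exact ⟨fun x => C + ∫ t in (0 : ℝ)..x, nonlin p (u e t), (hpair e).congr_deriv hI hC,
    (memLp_congr_ae hC).1 (hpair e).memLp_deriv, hnl, fun x _ => by simp⟩

theorem IsBoundState.exists_isClassicalSolution (hp : 2 < p) (H : G.IsBoundState p u) :
    ∃ v : G.Fun, G.IsClassicalSolution p u v := by
  classical
  choose v hv using H.exists_isEdgeSolution hp
  have hneu : ∀ k : Fin G.numPendants, v (.inr (.inl k)) (G.pendantLength k) = 0 := by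
    intro k
    -- The function `x` on the pendant, extended by zero, is zero at the vertex and nonzero at the
    -- tip, so it isolates the Neumann condition.
    have hid := H1Pair.id (G.pendantLength k)
    have h1 := H.2.2 _ (memH1_single (e := .inr (.inl k)) hid rfl (by simp))
    rw [integral_weakForm_single (fun e => (hv e).left) (e := .inr (.inl k)) hid] at h1
    have h2 := (hv (.inr (.inl k))).right.integral_Icc (G.pendantLength_pos k) hid
    rw [edgeSet] at h1
    rw [h1] at h2
    simp only [mul_zero, sub_zero, zero_eq_mul] at h2
    exact h2.resolve_right (G.pendantLength_pos k).ne'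
  refine ⟨v, hv, H.1.1.2.1, H.1.1.2.2, hneu, ?_⟩
  -- For the Kirchhoff condition: a test function equal to `1` on the compact part and decaying on
  -- the half-lines.
  let η : G.Fun := Sum.elim (fun _ x => Real.exp (-x)) (fun _ => 1)
  let ζ : G.Fun := Sum.elim (fun _ x => -Real.exp (-x)) (fun _ => 0)
  have hη : ∀ e, H1Pair (G.edgeSet e) (η e) (ζ e) := by
    rintro (k | k | k)
    · exact H1Pair.exp_neg
    · exact H1Pair.one _
    · exact H1Pair.one _
  have hη0 : ∀ e, η e 0 = 1 := by
    rintro (k | k | k) <;> simp [η]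
  have h := H.2.2 η (MemH1.of_h1Pair hη (fun e e' => by rw [hη0, hη0]) fun k => by simp [η])
  rw [integral_weakForm_eq_boundary hv hη] at h
  simp only [hη0, hneu] at h
  simp only [η, Sum.elim_inr, Pi.one_apply, mul_one, zero_sub, Finset.sum_neg_distrib,
    Finset.sum_sub_distrib] at h
  rw [Finset.sum_sub_distrib]
  linarith

/-! ### The action of a bound-state. -/

/-- The integral of `|u|^p` over the graph. -/
def lpIntegral (G : SingleKnotGraph) (p : ℝ) (u : G.Fun) : ℝ :=
  ∑ e, ∫ x in G.edgeSet e, |u e x| ^ p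

/-- The Nehari identity: test the equation with `u`. -/
theorem IsBoundState.sum_integral_eq (hp : 2 < p) (H : G.IsBoundState p u)
    (hg : ∀ e, H1Pair (G.edgeSet e) (u e) (g e)) :
    ∑ e, ∫ x in G.edgeSet e, (u e x ^ 2 + g e x ^ 2) = G.lpIntegral p u := by
  have h := H.2.2 u H.1
  rw [integral_weakForm_eq hg hg] at h
  rw [lpIntegral, ← sub_eq_zero, ← h, ← Finset.sum_sub_distrib]
  refine Finset.sum_congr rfl fun e _ => ?_
  rw [← MeasureTheory.integral_sub (hg e).integrable_sq_add_sq
    ((hg e).integrable_abs_rpow hp (isEdgeInterval_edgeSet e))]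
  congr 1; ext x
  rw [← abs_rpow_sub_two_mul_mul_self hp, nonlin]
  ring

/-- Reduces minimising the action to minimising `∫ |u|^p`, to which Fatou's lemma applies. -/
theorem IsBoundState.action_eq (hp : 2 < p) (H : G.IsBoundState p u) :
    G.action p u = (1 / 2 - 1 / p) * G.lpIntegral p u := by
  have h1 := H.sum_integral_eq hp (fun e => H.1.h1Pair e)
  have h2 : G.integral (fun e x => |G.weakDeriv u e x| ^ 2 + |u e x| ^ 2) = G.lpIntegral p u := by
    rw [← h1, integral]
    simp only [sq_abs, add_comm]
  rw [action, h2, integral, ← lpIntegral]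
  ring

theorem lpIntegral_nonneg : 0 ≤ G.lpIntegral p u :=
  Finset.sum_nonneg fun _ _ => integral_nonneg fun _ => by positivity

end SingleKnotGraph

/-! ### Lower bound on the compact part, from the condition on the lengths. -/

namespace SingleKnotGraph

variable {G : SingleKnotGraph} {p : ℝ} {u v : G.Fun}

/-- The left-hand side of the condition on the edge lengths. -/
def tanhSum (G : SingleKnotGraph) : ℝ :=
  (∑ k, Real.tanh (G.pendantLength k)) + 2 * (∑ k, Real.tanh (G.loopLength k / 2))

theorem tanhSum_nonneg (G : SingleKnotGraph) : 0 ≤ G.tanhSum := by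
  have h : ∀ x : ℝ, 0 < x → 0 ≤ Real.tanh x := fun x hx => by
    rw [Real.tanh_eq_sinh_div_cosh]
    exact div_nonneg (Real.sinh_nonneg_iff.2 hx.le) (Real.cosh_pos x).le
  refine add_nonneg (Finset.sum_nonneg fun k _ => h _ (G.pendantLength_pos k))
    (mul_nonneg zero_le_two (Finset.sum_nonneg fun k _ => h _ (half_pos (G.loopLength_pos k))))

/-- Negative values of `2j - H` are impossible because the sum is nonnegative; the others are the
excluded `H - 2n` with `n = H - j`. -/
theorem tanhSum_ne (htanh : ∀ n : ℕ, n ≤ G.numHalfLines / 2 →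
      (∑ k, Real.tanh (G.pendantLength k)) + 2 * (∑ k, Real.tanh (G.loopLength k / 2))
        ≠ (G.numHalfLines : ℝ) - 2 * (n : ℝ)) {j : ℕ} (hj : j ≤ G.numHalfLines) :
    G.tanhSum ≠ 2 * (j : ℝ) - G.numHalfLines := by
  intro h
  have h0 := G.tanhSum_nonneg
  rw [h] at h0
  have h1 : G.numHalfLines ≤ 2 * j := by
    have : (G.numHalfLines : ℝ) ≤ 2 * j := by linarith
    exact_mod_cast this
  refine htanh (G.numHalfLines - j) (by omega) ?_
  rw [← tanhSum, h, Nat.cast_sub hj]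
  ring

theorem sum_eq_of_eq_or_eq_neg {ι : Type*} [Fintype ι] {f : ι → ℝ} {a : ℝ}
    (h : ∀ i, f i = a ∨ f i = -a) :
    ∃ j ≤ Fintype.card ι, ∑ i, f i = a * (2 * (j : ℝ) - Fintype.card ι) := by
  classical
  refine ⟨(Finset.univ.filter fun i => f i = a).card, Finset.card_le_univ _, ?_⟩
  have h1 : ∀ i, f i = a * (2 * (if f i = a then 1 else 0) - 1) := by
    intro i
    split_ifs with hi
    · rw [hi]; ring
    · rw [(h i).resolve_left hi]; ring
  rw [Finset.sum_congr rfl fun i _ => h1 i, ← Finset.mul_sum, Finset.sum_sub_distrib,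
    ← Finset.mul_sum]
  simp

/-- Zero energy fixes each slope at the vertex up to sign, and `j` half-lines take the sign of `c`.
The bound `|c| < 1` keeps the radicand nonnegative. -/
theorem IsClassicalSolution.exists_halfLine_sum (hp : 2 < p) (H : G.IsClassicalSolution p u v)
    {c : ℝ} (hc : ∀ e, u e 0 = c) (hc1 : |c| < 1) :
    ∃ j ≤ G.numHalfLines, ∑ k, v (.inl k) 0 =
      c * √(1 - 2 / p * |c| ^ (p - 2)) * (2 * (j : ℝ) - G.numHalfLines) := by
  have h : ∀ k, v (.inl k) 0 = c * √(1 - 2 / p * |c| ^ (p - 2)) ∨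
      v (.inl k) 0 = -(c * √(1 - 2 / p * |c| ^ (p - 2))) := by
    intro k
    have he := IsEdgeSolution.energy_eq_zero hp (H.isEdgeSolution (.inl k))
    rw [hc, ← abs_rpow_sub_two_mul_mul_self hp] at he
    have h1 : |c| ^ (p - 2) ≤ 1 := Real.rpow_le_one (abs_nonneg c) hc1.le (by linarith)
    have h2 : 2 / p ≤ 1 := (div_le_one (by linarith)).2 hp.le
    have h3 : (0 : ℝ) ≤ 2 / p := by positivity
    have h4 : (0 : ℝ) ≤ |c| ^ (p - 2) := by positivity
    rw [← sq_eq_sq_iff_eq_or_eq_neg, mul_pow, Real.sq_sqrt (by nlinarith)]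
    linarith
  obtain ⟨j, hj, hs⟩ := sum_eq_of_eq_or_eq_neg h
  rw [Fintype.card_fin] at hj hs
  exact ⟨j, hj, hs⟩

theorem IsClassicalSolution.abs_le (hp : 2 < p) (H : G.IsClassicalSolution p u v)
    {c : ℝ} (hc : ∀ e, u e 0 = c)
    (hu : ∀ b, ∀ x ∈ G.edgeSet (.inr b), |u (.inr b) x| ≤ 1) (b) {x : ℝ}
    (hx : x ∈ G.edgeSet (.inr b)) : |u (.inr b) x| ≤ |c| := by
  rw [← hc (.inr b)]
  rcases b with k | k
  · exact (H.isEdgeSolution (.inr (.inl k))).abs_le_abs_zero hp (G.pendantLength_pos k)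
      (hu (.inl k))
      (Or.inl (H.neumann k)) hx
  · exact (H.isEdgeSolution (.inr (.inr k))).abs_le_abs_zero hp (G.loopLength_pos k)
      (hu (.inr k))
      (Or.inr (H.loop k)) hx

/-- On a half-line zero energy forces zero slope, and uniqueness applies; on bounded edges the
maximum principle does. -/
theorem IsClassicalSolution.eq_zero (hp : 2 < p) (H : G.IsClassicalSolution p u v)
    (hc : ∀ e, u e 0 = 0)
    (hu : ∀ b, ∀ x ∈ G.edgeSet (.inr b), |u (.inr b) x| ≤ 1) (e) {x : ℝ}
    (hx : x ∈ G.edgeSet e) : u e x = 0 := by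
  rcases e with k | b
  · have hs := H.isEdgeSolution (.inl k)
    have h := IsEdgeSolution.energy_eq_zero hp hs
    rw [hc] at h
    have hv : v (.inl k) 0 = 0 := by
      simpa [show p ≠ 0 by linarith] using h
    exact hs.eq_zero hp (isEdgeInterval_edgeSet _) (hc _) hv hx
  · simpa using H.abs_le hp hc hu b hx

/-- The total of the error terms in the linearisation of the Kirchhoff condition. -/
def errorConst (G : SingleKnotGraph) : ℝ :=
  (∑ k, Real.cosh (G.pendantLength k) * G.pendantLength k) +
    ∑ k, Real.cosh (G.loopLength k) * G.loopLength k

/-- The Kirchhoff condition with the bounded edges linearised. By the maximum principle `|u| ≤ |c|`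
there, so the errors are of order `|c|^(p-1)`. -/
theorem IsClassicalSolution.abs_halfLine_sum_sub_le (hp : 2 < p)
    (H : G.IsClassicalSolution p u v) {c : ℝ} (hc : ∀ e, u e 0 = c)
    (hu : ∀ b, ∀ x ∈ G.edgeSet (.inr b), |u (.inr b) x| ≤ 1) :
    |∑ k, v (.inl k) 0 - c * G.tanhSum| ≤ |c| ^ (p - 2) * |c| * G.errorConst := by
  have hP : ∀ k : Fin G.numPendants,
      |v (.inr (.inl k)) 0 + c * Real.tanh (G.pendantLength k)| ≤
        |c| ^ (p - 2) * |c| * (Real.cosh (G.pendantLength k) * G.pendantLength k) := by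
    intro k
    have hl := G.pendantLength_pos k
    -- Centring the cosine at the tip removes the unknown value of `u` there, because `sinh 0 = 0`.
    have h := (H.isEdgeSolution (.inr (.inl k))).abs_cosh_test_le hp hl (a := G.pendantLength k)
      ⟨hl.le, le_rfl⟩ (fun x hx => H.abs_le hp hc hu (.inl k) hx)
    rw [H.neumann, hc, sub_self, Real.sinh_zero] at h
    have hcosh := Real.cosh_pos (G.pendantLength k)
    have e : 0 * Real.cosh 0 - u (.inr (.inl k)) (G.pendantLength k) * 0 -
        (v (.inr (.inl k)) 0 * Real.cosh (G.pendantLength k) + c * Real.sinh (G.pendantLength k)) =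
        -((v (.inr (.inl k)) 0 + c * Real.tanh (G.pendantLength k)) *
          Real.cosh (G.pendantLength k)) := by
      rw [Real.tanh_eq_sinh_div_cosh]
      field_simp
      ring
    rw [e, abs_neg, abs_mul, abs_of_pos hcosh] at h
    have := Real.one_le_cosh (G.pendantLength k)
    have := abs_nonneg (v (.inr (.inl k)) 0 + c * Real.tanh (G.pendantLength k))
    nlinarith
  have hL : ∀ k : Fin G.numLoops,
      |v (.inr (.inr k)) 0 - v (.inr (.inr k)) (G.loopLength k) +
        c * (2 * Real.tanh (G.loopLength k / 2))| ≤
        |c| ^ (p - 2) * |c| * (Real.cosh (G.loopLength k) * G.loopLength k) := by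
    intro k
    have hl := G.loopLength_pos k
    -- Centring at the midpoint gives both end slopes the same weight, so only their difference
    -- enters.
    have h := (H.isEdgeSolution (.inr (.inr k))).abs_cosh_test_le hp hl (a := G.loopLength k / 2)
      ⟨by linarith, by linarith⟩ (fun x hx => H.abs_le hp hc hu (.inr k) hx)
    rw [H.loop, hc, sub_half] at h
    have hcosh := Real.cosh_pos (G.loopLength k / 2)
    have e : v (.inr (.inr k)) (G.loopLength k) * Real.cosh (G.loopLength k / 2) -
        c * Real.sinh (G.loopLength k / 2) -
        (v (.inr (.inr k)) 0 * Real.cosh (G.loopLength k / 2) +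
          c * Real.sinh (G.loopLength k / 2)) =
        -((v (.inr (.inr k)) 0 - v (.inr (.inr k)) (G.loopLength k) +
        c * (2 * Real.tanh (G.loopLength k / 2))) * Real.cosh (G.loopLength k / 2)) := by
      rw [Real.tanh_eq_sinh_div_cosh]
      field_simp
      ring
    rw [e, abs_neg, abs_mul, abs_of_pos hcosh] at h
    have := Real.one_le_cosh (G.loopLength k / 2)
    have := abs_nonneg (v (.inr (.inr k)) 0 - v (.inr (.inr k)) (G.loopLength k) +
        c * (2 * Real.tanh (G.loopLength k / 2)))
    nlinarith
  have e : ∑ k, v (.inl k) 0 - c * G.tanhSum =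
      -((∑ k, (v (.inr (.inl k)) 0 + c * Real.tanh (G.pendantLength k))) +
      ∑ k, (v (.inr (.inr k)) 0 - v (.inr (.inr k)) (G.loopLength k) +
        c * (2 * Real.tanh (G.loopLength k / 2)))) := by
    have hk := H.kirchhoff
    rw [Finset.sum_add_distrib, Finset.sum_add_distrib, ← Finset.mul_sum, ← Finset.mul_sum,
      ← Finset.mul_sum, tanhSum]
    linarith
  rw [e, abs_neg, errorConst, mul_add]
  refine (abs_add_le _ _).trans (add_le_add ?_ ?_)
  · rw [Finset.mul_sum]
    exact (Finset.abs_sum_le_sum_abs _ _).trans (Finset.sum_le_sum fun k _ => hP k)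
  · rw [Finset.mul_sum]
    exact (Finset.abs_sum_le_sum_abs _ _).trans (Finset.sum_le_sum fun k _ => hL k)

/-- Under the condition on the edge lengths, nontrivial solutions are not small on the compact part
of the graph. -/
theorem exists_pos_lower_bound (hp : 2 < p) (htanh : ∀ n : ℕ, n ≤ G.numHalfLines / 2 →
      (∑ k, Real.tanh (G.pendantLength k)) + 2 * (∑ k, Real.tanh (G.loopLength k / 2))
        ≠ (G.numHalfLines : ℝ) - 2 * (n : ℝ)) :
    ∃ δ > 0, ∀ u v : G.Fun, G.IsClassicalSolution p u v → (∀ e, |u e 0| < δ) →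
      (∀ b, ∀ x ∈ G.edgeSet (.inr b), |u (.inr b) x| < δ) →
      ∀ e, ∀ x ∈ G.edgeSet e, u e x = 0 := by
  -- At `c = 0` the left side is `0` and the right side is `|2j - H - tanhSum| > 0`; continuity and
  -- the finiteness of the set of `j` do the rest.
  have hev : ∀ᶠ c : ℝ in 𝓝 0, ∀ j ∈ Finset.range (G.numHalfLines + 1),
      |c| ^ (p - 2) * G.errorConst <
        |√(1 - 2 / p * |c| ^ (p - 2)) * (2 * (j : ℝ) - G.numHalfLines) - G.tanhSum| := by
    rw [eventually_all_finset]
    intro j hj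
    have hcont : Continuous fun c : ℝ => |c| ^ (p - 2) :=
      continuous_abs.rpow_const fun _ => Or.inr (by linarith)
    have hp2 : p - 2 ≠ 0 := by linarith
    refine ContinuousAt.eventually_lt (hcont.mul continuous_const).continuousAt
      (((((continuous_const.sub (continuous_const.mul hcont)).sqrt).mul
        continuous_const).sub continuous_const).abs).continuousAt ?_
    simp only [abs_zero, Real.zero_rpow hp2, zero_mul, mul_zero, sub_zero, Real.sqrt_one, one_mul]
    rw [abs_pos, sub_ne_zero]
    exact (tanhSum_ne htanh (Nat.lt_succ_iff.1 (Finset.mem_range.1 hj))).symm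
  obtain ⟨ε, hε, hεj⟩ := Metric.eventually_nhds_iff.1 hev
  -- The bound by `1` makes the maximum principle available.
  refine ⟨min ε 1, lt_min hε one_pos, fun u v H hu0 hu e x hx => ?_⟩
  have hu1 : ∀ b, ∀ x ∈ G.edgeSet (.inr b), |u (.inr b) x| ≤ 1 := fun b x hx =>
    (hu b x hx).le.trans (min_le_right _ _)
  set c := u e 0 with hcdef
  have hc : ∀ e', u e' 0 = c := fun e' => H.vertex e' e
  rcases eq_or_ne c 0 with h0 | h0
  · exact H.eq_zero hp (fun e' => (hc e').trans h0) hu1 e hx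
  · exfalso
    have hclt := hu0 e
    obtain ⟨j, hj, hs⟩ := H.exists_halfLine_sum hp hc (hclt.trans_le (min_le_right _ _))
    have h1 := H.abs_halfLine_sum_sub_le hp hc hu1
    rw [hs, mul_assoc, ← mul_sub, abs_mul] at h1
    have h2 := hεj (y := c) (by simpa using hclt.trans_le (min_le_left _ _)) j
      (Finset.mem_range.2 (Nat.lt_succ_iff.2 hj))
    have h3 : 0 < |c| := abs_pos.2 h0
    nlinarith [mul_lt_mul_of_pos_left h2 h3]

end SingleKnotGraph

/-! ### Compactness of bounded families of solutions. -/

/-- Fatou's lemma for Bochner integrals of nonnegative functions. -/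
theorem integrable_and_integral_le_of_tendsto {α : Type*} [MeasurableSpace α] {μ : Measure α}
    {F : ℕ → α → ℝ} {f : α → ℝ} {C : ℝ} (hF : ∀ n, Integrable (F n) μ)
    (hF0 : ∀ n x, 0 ≤ F n x) (hC : ∀ᶠ n in atTop, ∫ x, F n x ∂μ ≤ C)
    (hlim : ∀ᵐ x ∂μ, Tendsto (fun n => F n x) atTop (𝓝 (f x))) :
    Integrable f μ ∧ ∫ x, f x ∂μ ≤ C := by
  have hf : AEStronglyMeasurable f μ := aestronglyMeasurable_of_tendsto_ae atTop
    (fun n => (hF n).1) hlim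
  have hf0 : 0 ≤ᵐ[μ] f := by
    filter_upwards [hlim] with x hx
    exact ge_of_tendsto' hx fun n => hF0 n x
  have hC0 : 0 ≤ C := by
    obtain ⟨n, hn⟩ := hC.exists
    exact (integral_nonneg (hF0 n)).trans hn
  have hle : ∫⁻ x, ENNReal.ofReal (f x) ∂μ ≤ ENNReal.ofReal C := by
    calc ∫⁻ x, ENNReal.ofReal (f x) ∂μ
        = ∫⁻ x, liminf (fun n => ENNReal.ofReal (F n x)) atTop ∂μ := by
          refine lintegral_congr_ae ?_
          filter_upwards [hlim] with x hx
          exact ((ENNReal.tendsto_ofReal hx).liminf_eq).symm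
      _ ≤ liminf (fun n => ∫⁻ x, ENNReal.ofReal (F n x) ∂μ) atTop :=
          lintegral_liminf_le' fun n => (hF n).1.aemeasurable.ennreal_ofReal
      _ ≤ ENNReal.ofReal C := by
          refine liminf_le_of_frequently_le' (Eventually.frequently ?_)
          filter_upwards [hC] with n hn
          rw [← ofReal_integral_eq_lintegral_ofReal (hF n) (Eventually.of_forall (hF0 n))]
          exact ENNReal.ofReal_le_ofReal hn
  refine ⟨⟨hf, ?_⟩, ?_⟩
  · rw [hasFiniteIntegral_iff_ofReal hf0]
    exact hle.trans_lt ENNReal.ofReal_lt_top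
  · rw [integral_eq_lintegral_of_nonneg_ae hf0 hf]
    exact ENNReal.toReal_le_of_le_ofReal hC0 hle

namespace IsEdgeSolution

variable {p : ℝ} {I : Set ℝ}

/-- The Sobolev inequality is used twice: first for `u`, then for `v`, whose derivative `nonlin p u`
is now controlled by a multiple of `|u|`. -/
theorem exists_uniform_bound (hp : 2 < p) (hI : IsEdgeInterval I) (C : ℝ) :
    ∃ M, ∀ u v : ℝ → ℝ, IsEdgeSolution p I u v → ∫ x in I, (u x ^ 2 + v x ^ 2) ≤ C →
      ∀ x ∈ I, |u x| ≤ M ∧ |v x| ≤ M := by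
  obtain ⟨d, hd, hd0⟩ := hI.exists_pos_mem
  set M := √(C / d + C)
  set B := (1 + M ^ (p - 2)) ^ 2 with hB
  refine ⟨max M √(B * C / d + B * C), fun u v H hC x hx => ?_⟩
  have hM : ∀ x ∈ I, |u x| ≤ M := fun x hx => Real.abs_le_sqrt (H.left.sq_le hI hd hd0 hC hx)
  have hM0 : 0 ≤ M := Real.sqrt_nonneg _
  have hB1 : 1 ≤ B := by
    have : 0 ≤ M ^ (p - 2) := by positivity
    nlinarith
  have hBC : ∫ x in I, (v x ^ 2 + nonlin p (u x) ^ 2) ≤ B * C := by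
    calc ∫ x in I, (v x ^ 2 + nonlin p (u x) ^ 2) ≤ ∫ x in I, B * (u x ^ 2 + v x ^ 2) := by
          refine setIntegral_mono_on H.right.integrable_sq_add_sq
            (H.left.integrable_sq_add_sq.const_mul B) hI.measurableSet fun x hx => ?_
          have h1 := abs_nonlin_le hp (hM x hx)
          have h2 : nonlin p (u x) ^ 2 ≤ B * u x ^ 2 := by
            rw [hB, ← sq_abs (u x), ← mul_pow, ← sq_abs (nonlin p (u x))]
            exact pow_le_pow_left₀ (abs_nonneg _) h1 2
          nlinarith [sq_nonneg (v x)]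
      _ = B * ∫ x in I, (u x ^ 2 + v x ^ 2) := MeasureTheory.integral_const_mul _ _
      _ ≤ B * C := by gcongr
  exact ⟨(hM x hx).trans (le_max_left _ _),
    (Real.abs_le_sqrt (H.right.sq_le hI hd hd0 hBC hx)).trans (le_max_right _ _)⟩

/-- Compactness of bounded sets of solutions on an edge. -/
theorem exists_limit (hp : 2 < p) (hI : IsEdgeInterval I) {u v : ℕ → ℝ → ℝ} {C : ℝ}
    (H : ∀ n, IsEdgeSolution p I (u n) (v n))
    (hC : ∀ n, ∫ x in I, (u n x ^ 2 + v n x ^ 2) ≤ C) {z : ℝ × ℝ}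
    (hz : Tendsto (fun n => (u n 0, v n 0)) atTop (𝓝 z)) :
    ∃ U V : ℝ → ℝ, IsEdgeSolution p I U V ∧
      (∀ x ∈ I, Tendsto (fun n => u n x) atTop (𝓝 (U x))) ∧
      (∀ x ∈ I, Tendsto (fun n => v n x) atTop (𝓝 (V x))) ∧
      ∀ b, ∀ ε > 0, ∀ᶠ n in atTop, ∀ x ∈ I, x ≤ b → |u n x - U x| < ε := by
  obtain ⟨M, hM⟩ := exists_uniform_bound hp hI C
  have hMu : ∀ n, ∀ x ∈ I, |u n x| ≤ M := fun n x hx => (hM _ _ (H n) (hC n) x hx).1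
  have hMv : ∀ n, ∀ x ∈ I, |v n x| ≤ M := fun n x hx => (hM _ _ (H n) (hC n) x hx).2
  obtain ⟨K, hK⟩ := exists_lipschitzOnWith_nonlin hp M
  -- Continuous dependence makes `(u n x, v n x)` a Cauchy sequence for each `x`, so no further
  -- subsequence is needed.
  have hex : ∀ x, ∃ w : ℝ × ℝ, x ∈ I → Tendsto (fun n => (u n x, v n x)) atTop (𝓝 w) := by
    intro x
    by_cases hx : x ∈ I
    · have hcs : CauchySeq fun n => (u n x, v n x) := by
        rw [cauchySeq_iff_tendsto_dist_atTop_0]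
        have h0 := cauchySeq_iff_tendsto_dist_atTop_0.1 hz.cauchySeq
        have h1 := h0.mul_const (Real.exp ((max 1 K : NNReal) * x))
        rw [zero_mul] at h1
        exact squeeze_zero (fun _ => dist_nonneg)
          (fun m => (H m.1).dist_le hp hI (H m.2) hK (hMu _) (hMu _) hx) h1
      obtain ⟨w, hw⟩ := cauchySeq_tendsto_of_complete hcs
      exact ⟨w, fun _ => hw⟩
    · exact ⟨0, fun h => absurd h hx⟩
  choose w hw using hex
  have hU : ∀ x ∈ I, Tendsto (fun n => u n x) atTop (𝓝 (w x).1) := fun x hx =>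
    (continuous_fst.tendsto _).comp (hw x hx)
  have hV : ∀ x ∈ I, Tendsto (fun n => v n x) atTop (𝓝 (w x).2) := fun x hx =>
    (continuous_snd.tendsto _).comp (hw x hx)
  have hN : ∀ x ∈ I, Tendsto (fun n => nonlin p (u n x)) atTop (𝓝 (nonlin p (w x).1)) :=
    fun x hx => ((continuous_nonlin hp).tendsto _).comp (hU x hx)
  have hL2 : ∀ (f g : ℕ → ℝ → ℝ) (F : ℝ → ℝ), (∀ n, H1Pair I (f n) (g n)) →
      (∀ n x, f n x ^ 2 ≤ u n x ^ 2 + v n x ^ 2) →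
      (∀ x ∈ I, Tendsto (fun n => f n x) atTop (𝓝 (F x))) → MemLp F 2 (volume.restrict I) := by
    intro f g F hfg hle hlim
    have hlim' : ∀ᵐ x ∂volume.restrict I, Tendsto (fun n => f n x) atTop (𝓝 (F x)) :=
      (ae_restrict_iff' hI.measurableSet).2 (Eventually.of_forall hlim)
    rw [memLp_two_iff_integrable_sq
      (aestronglyMeasurable_of_tendsto_ae atTop (fun n => (hfg n).memLp.1) hlim')]
    refine (integrable_and_integral_le_of_tendsto (F := fun n x => f n x ^ 2) (C := C)
      (fun n => (hfg n).memLp.integrable_sq) (fun n x => sq_nonneg _)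
      (Eventually.of_forall fun n => ?_) ?_).1
    · exact (integral_mono (hfg n).memLp.integrable_sq (H n).left.integrable_sq_add_sq
        (hle n)).trans (hC n)
    · filter_upwards [hlim'] with x hx
      exact hx.pow 2
  have hprim : ∀ (f g : ℕ → ℝ → ℝ) (F Γ : ℝ → ℝ) (B : ℝ), (∀ n, H1Pair I (f n) (g n)) →
      (∀ n, ∀ x ∈ I, |g n x| ≤ B) →
      (∀ x ∈ I, Tendsto (fun n => f n x) atTop (𝓝 (F x))) →
      (∀ x ∈ I, Tendsto (fun n => g n x) atTop (𝓝 (Γ x))) →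
      ∀ x ∈ I, F x = F 0 + ∫ t in (0 : ℝ)..x, Γ t := by
    intro f g F Γ B hfg hB hf hg x hx
    have hsub : ∀ t ∈ uIoc 0 x, t ∈ I := fun t ht => by
      rw [uIoc_of_le (hI.nonneg hx)] at ht
      exact hI.Icc_subset hx ⟨ht.1.le, ht.2⟩
    have hint : Tendsto (fun n => ∫ t in (0 : ℝ)..x, g n t) atTop
        (𝓝 (∫ t in (0 : ℝ)..x, Γ t)) := by
      refine tendsto_integral_filter_of_dominated_convergence (fun _ => B) ?_ ?_ (by simp) ?_
      · exact Eventually.of_forall fun n =>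
          ((hfg n).memLp_deriv.1).mono_measure (Measure.restrict_mono hsub le_rfl)
      · exact Eventually.of_forall fun n => Eventually.of_forall fun t ht => hB n t (hsub t ht)
      · exact Eventually.of_forall fun t ht => hg t (hsub t ht)
    refine tendsto_nhds_unique (hf x hx) (((hf 0 hI.zero_mem).add hint).congr fun n => ?_)
    exact ((hfg n).eq_integral x hx).symm
  have hleft : H1Pair I (fun x => (w x).1) (fun x => (w x).2) :=
    ⟨hL2 u v _ (fun n => (H n).left) (fun n x => by nlinarith [sq_nonneg (v n x)]) hU,
      hL2 v _ _ (fun n => (H n).right) (fun n x => by nlinarith [sq_nonneg (u n x)]) hV,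
      hprim u v _ _ M (fun n => (H n).left) hMv hU hV⟩
  have hsol : IsEdgeSolution p I (fun x => (w x).1) (fun x => (w x).2) := by
    refine ⟨hleft, hleft.memLp_deriv, hleft.memLp_nonlin hp hI, ?_⟩
    refine hprim v _ _ _ ((1 + M ^ (p - 2)) * M) (fun n => (H n).right) (fun n x hx => ?_) hV hN
    have hM0 : 0 ≤ M := (abs_nonneg _).trans (hMu n x hx)
    refine (abs_nonlin_le hp (hMu n x hx)).trans ?_
    gcongr
    exact hMu n x hx
  have hMU : ∀ x ∈ I, |(w x).1| ≤ M := fun x hx =>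
    le_of_tendsto' (hU x hx).abs fun n => hMu n x hx
  refine ⟨_, _, hsol, hU, hV, fun b ε hε => ?_⟩
  have hd := ((hw 0 hI.zero_mem).dist (tendsto_const_nhds (x := w 0))).mul_const
    (Real.exp ((max 1 K : NNReal) * b))
  rw [dist_self, zero_mul] at hd
  filter_upwards [hd.eventually (gt_mem_nhds hε)] with n hn x hx hxb
  have h1 := (H n).dist_le hp hI hsol hK (hMu n) hMU hx
  have h2 : |u n x - (w x).1| ≤ dist (u n x, v n x) ((w x).1, (w x).2) := by
    rw [Prod.dist_eq, Real.dist_eq]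
    exact le_max_left _ _
  refine (h2.trans (h1.trans ?_)).trans_lt hn
  gcongr

end IsEdgeSolution

namespace SingleKnotGraph

variable {G : SingleKnotGraph} {p : ℝ} {u v : G.Fun}

theorem lpIntegral_edge_le {e : G.Edge} :
    ∫ x in G.edgeSet e, |u e x| ^ p ≤ G.lpIntegral p u :=
  Finset.single_le_sum (f := fun e => ∫ x in G.edgeSet e, |u e x| ^ p)
    (fun _ _ => integral_nonneg fun _ => by positivity) (Finset.mem_univ e)

theorem IsBoundState.edge_integral_le (hp : 2 < p) (H : G.IsBoundState p u)
    (hv : G.IsClassicalSolution p u v) (e : G.Edge) :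
    ∫ x in G.edgeSet e, (u e x ^ 2 + v e x ^ 2) ≤ G.lpIntegral p u := by
  rw [← H.sum_integral_eq hp fun e => (hv.isEdgeSolution e).left]
  exact Finset.single_le_sum (f := fun e => ∫ x in G.edgeSet e, (u e x ^ 2 + v e x ^ 2))
    (fun _ _ => integral_nonneg fun _ => by positivity) (Finset.mem_univ e)

/-- Bounded sequences of bound-states have a subsequence that converges, uniformly on the compact
part of the graph, to a solution. -/
theorem exists_limit_isClassicalSolution (hp : 2 < p) {u v : ℕ → G.Fun} {C m : ℝ}
    (hu : ∀ n, G.IsBoundState p (u n)) (hv : ∀ n, G.IsClassicalSolution p (u n) (v n))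
    (hC : ∀ n, G.lpIntegral p (u n) ≤ C)
    (hm : Tendsto (fun n => G.lpIntegral p (u n)) atTop (𝓝 m)) :
    ∃ (U V : G.Fun) (φ : ℕ → ℕ), G.IsClassicalSolution p U V ∧ G.lpIntegral p U ≤ m ∧
      ∀ e b, ∀ ε > 0, ∀ᶠ n in atTop, ∀ x ∈ G.edgeSet e, x ≤ b → |u (φ n) e x - U e x| < ε := by
  have hI := fun e => isEdgeInterval_edgeSet (G := G) e
  have hC' : ∀ n e, ∫ x in G.edgeSet e, (u n e x ^ 2 + v n e x ^ 2) ≤ C := fun n e =>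
    ((hu n).edge_integral_le hp (hv n) e).trans (hC n)
  choose M hM using fun e => IsEdgeSolution.exists_uniform_bound (p := p) hp (hI e) C
  have hMn := fun n e => hM e _ _ ((hv n).isEdgeSolution e) (hC' n e) 0 (hI e).zero_mem
  -- Besides the Cauchy data, the integral of `|u|^p` over each edge is made to converge, so that
  -- Fatou's lemma can be applied edge by edge and the limits add up to `m`.
  obtain ⟨z, -, φ, hφ, hz⟩ := (isCompact_univ_pi fun e : G.Edge =>
    (isCompact_Icc (a := -M e) (b := M e)).prod ((isCompact_Icc (a := -M e) (b := M e)).prod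
      (isCompact_Icc (a := (0 : ℝ)) (b := C)))).tendsto_subseq
    (x := fun n e => (u n e 0, v n e 0, ∫ x in G.edgeSet e, |u n e x| ^ p))
    (fun n e _ => ⟨abs_le.1 (hMn n e).1, abs_le.1 (hMn n e).2,
      integral_nonneg fun _ => by positivity, lpIntegral_edge_le.trans (hC n)⟩)
  have hz1 : ∀ e, Tendsto (fun n => (u (φ n) e 0, v (φ n) e 0)) atTop
      (𝓝 ((z e).1, (z e).2.1)) := fun e => by
    have := (tendsto_pi_nhds.1 hz) e
    exact ((continuous_fst.tendsto _).comp this).prodMk_nhds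
      (((continuous_fst.comp continuous_snd).tendsto _).comp this)
  have hz2 : ∀ e, Tendsto (fun n => ∫ x in G.edgeSet e, |u (φ n) e x| ^ p) atTop
      (𝓝 (z e).2.2) := fun e =>
    ((continuous_snd.comp continuous_snd).tendsto _).comp ((tendsto_pi_nhds.1 hz) e)
  choose U V hs hU hV hunif using fun e => IsEdgeSolution.exists_limit (p := p) hp (hI e)
    (fun n => (hv (φ n)).isEdgeSolution e) (fun n => hC' (φ n) e) (hz1 e)
  refine ⟨U, V, φ, ⟨hs, fun e e' => ?_, fun k => ?_, fun k => ?_, ?_⟩, ?_, hunif⟩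
  · exact tendsto_nhds_unique (hU e 0 (hI e).zero_mem)
      ((hU e' 0 (hI e').zero_mem).congr fun n => (hv (φ n)).vertex e' e)
  · have hl : G.loopLength k ∈ G.edgeSet (.inr (.inr k)) := ⟨(G.loopLength_pos k).le, le_rfl⟩
    exact tendsto_nhds_unique (hU _ _ hl)
      ((hU _ 0 (hI _).zero_mem).congr fun n => ((hv (φ n)).loop k).symm)
  · have hl : G.pendantLength k ∈ G.edgeSet (.inr (.inl k)) :=
      ⟨(G.pendantLength_pos k).le, le_rfl⟩
    exact tendsto_nhds_unique (hV _ _ hl)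
      (tendsto_const_nhds.congr fun n => ((hv (φ n)).neumann k).symm)
  · have h0 := fun e => hV e 0 (hI e).zero_mem
    have hl := fun k => hV (.inr (.inr k)) (G.loopLength k) ⟨(G.loopLength_pos k).le, le_rfl⟩
    refine tendsto_nhds_unique (((tendsto_finsetSum Finset.univ fun k _ => h0 (.inl k)).add
      (tendsto_finsetSum Finset.univ fun k _ => h0 (.inr (.inl k)))).add
      (tendsto_finsetSum Finset.univ fun k _ => (h0 (.inr (.inr k))).sub (hl k)))
      (tendsto_const_nhds.congr fun n => ((hv (φ n)).kirchhoff).symm)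
  · have hsum : ∑ e, (z e).2.2 = m := tendsto_nhds_unique
      (tendsto_finsetSum Finset.univ fun e _ => hz2 e) (hm.comp hφ.tendsto_atTop)
    rw [← hsum, lpIntegral]
    refine Finset.sum_le_sum fun e _ => le_of_forall_pos_le_add fun ε hε => ?_
    refine (integrable_and_integral_le_of_tendsto (F := fun n x => |u (φ n) e x| ^ p)
      (fun n => ((hv (φ n)).isEdgeSolution e).left.integrable_abs_rpow hp (hI e))
      (fun _ _ => by positivity) ?_ ?_).2
    · filter_upwards [(hz2 e).eventually (gt_mem_nhds (lt_add_of_pos_right _ hε))] with n hn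
      exact hn.le
    · refine (ae_restrict_iff' (hI e).measurableSet).2 (Eventually.of_forall fun x hx => ?_)
      exact (hU e x hx).abs.rpow_const (Or.inr (by linarith))

end SingleKnotGraph

end

/-! ### Existence of a minimiser. -/

open Filter Topology in
theorem mainTheorem2 (p : ℝ) (hp : 2 < p) (G : SingleKnotGraph)
    (hbound : ∃ u : G.Fun, G.IsBoundState p u)
    (htanh : ∀ n : ℕ, n ≤ G.numHalfLines / 2 →
      (∑ k, Real.tanh (G.pendantLength k)) + 2 * (∑ k, Real.tanh (G.loopLength k / 2))
        ≠ (G.numHalfLines : ℝ) - 2 * (n : ℝ)) :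
    ∃ u : G.Fun, G.IsActionGroundState p u := by
  set A : Set ℝ := {a | ∃ u : G.Fun, G.IsBoundState p u ∧ G.lpIntegral p u = a} with hA
  have hne : A.Nonempty := let ⟨u, hu⟩ := hbound; ⟨_, u, hu, rfl⟩
  have hbdd : BddBelow A := ⟨0, by rintro _ ⟨u, -, rfl⟩; exact SingleKnotGraph.lpIntegral_nonneg⟩
  obtain ⟨a, -, ha, haA⟩ := exists_seq_tendsto_sInf hne hbdd
  choose u hu hua using haA
  have hm : Tendsto (fun n => G.lpIntegral p (u n)) atTop (𝓝 (sInf A)) := by simpa only [hua] using ha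
  obtain ⟨C, hC⟩ := hm.bddAbove_range
  choose v hv using fun n => (hu n).exists_isClassicalSolution hp
  obtain ⟨U, V, φ, hUV, hUm, hunif⟩ := SingleKnotGraph.exists_limit_isClassicalSolution hp hu hv
    (fun n => hC ⟨n, rfl⟩) hm
  have hU0 : ∃ e, ∃ x ∈ G.edgeSet e, U e x ≠ 0 := by
    by_contra! hcon
    obtain ⟨δ, hδ, hlow⟩ := SingleKnotGraph.exists_pos_lower_bound hp htanh
    have hsmall : ∀ b : ℝ, ∀ᶠ n in atTop, ∀ e, ∀ x ∈ G.edgeSet e, x ≤ b → |u (φ n) e x| < δ := by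
      intro b
      rw [eventually_all]
      intro e
      filter_upwards [hunif e b δ hδ] with n hn x hx hxb
      simpa [hcon e x hx] using hn x hx hxb
    obtain ⟨b, hb⟩ : ∃ b : ℝ, ∀ e', ∀ x ∈ G.edgeSet (.inr e'), x ≤ b := by
      refine ⟨∑ k, G.pendantLength k + ∑ k, G.loopLength k, ?_⟩
      have h1 : 0 ≤ ∑ k, G.pendantLength k :=
        Finset.sum_nonneg fun k _ => (G.pendantLength_pos k).le
      have h2 : 0 ≤ ∑ k, G.loopLength k := Finset.sum_nonneg fun k _ => (G.loopLength_pos k).le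
      rintro (k | k) x hx
      · have := Finset.single_le_sum (f := G.pendantLength)
          (fun k _ => (G.pendantLength_pos k).le) (Finset.mem_univ k)
        linarith [hx.2]
      · have := Finset.single_le_sum (f := G.loopLength)
          (fun k _ => (G.loopLength_pos k).le) (Finset.mem_univ k)
        linarith [hx.2]
    -- The bound with `x ≤ 0` covers the vertex on every edge, the one with `x ≤ b` the whole
    -- compact part. Smallness far out on the half-lines is neither known nor needed.
    obtain ⟨n, hn0, hnb⟩ := ((hsmall 0).and (hsmall b)).exists
    obtain ⟨e, x, hx, hxne⟩ := (hu (φ n)).2.1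
    exact hxne (hlow _ _ (hv (φ n))
      (fun e => hn0 e 0 (SingleKnotGraph.isEdgeInterval_edgeSet e).zero_mem le_rfl)
      (fun e' x hx => hnb _ x hx (hb e' x hx)) e x hx)
  have hUb := hUV.isBoundState hU0
  refine ⟨U, hUb, le_antisymm (le_iInf₂ fun w hw => ?_) (iInf₂_le U hUb)⟩
  rw [EReal.coe_le_coe_iff, hUb.action_eq hp, hw.action_eq hp]
  have hκ : 0 ≤ 1 / 2 - 1 / p := by
    rw [sub_nonneg]
    exact one_div_le_one_div_of_le two_pos hp.le
  exact mul_le_mul_of_nonneg_left (hUm.trans (csInf_le hbdd ⟨w, hw, rfl⟩)) hκ
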